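/- For $x\in\mathbb C$ and $n\in\mathbb N$ let $(x)_n=x(x+1)\cdots(x+n-1)$, and for complex $a$ let $(x)_a=\Gamma(x+a)/\Gamma(x)$. For $a\in\mathbb C\setminus\{-1,-2,-3,\dots\}$ let $$f(a)=\sum_{n=0}^{\infty}\frac1{2^{2n}}\,\frac{\left(a+\frac12\right)_n^3}{(a+1)_n^3}\,[6(n+a)+1];$$ this series converges (absolutely). Then the following hold. (1) If $\operatorname{Re}a>0$, the series on the right below converges absolutely and $$f(a)=8a\sum_{n=0}^\infty\frac{\left(\frac12\right)_n^2}{(a+1)_n^2}.$$ (2) If $\operatorname{Re}a<\frac12$, $a\notin\{-1,-2,-3,\dots\}$ and $\cos\pi a\ne0$, the series on the right below converges absolutely and $$f(a)=\frac4\pi\cdot\frac{4^a}{\cos^2\pi a}\cdot\frac{(1)_a^3}{\left(\frac12\right)_a^3}+\frac{16a^2}{2a-1}\sum_{n=0}^\infty\frac{\left(\frac12\right)_n\left(a+\frac12\right)_n}{(a+1)_n\left(\frac32-a\right)_n}.$$ (3) $f\left(\frac12\right)=\frac{\pi^2}2$ and $f(0)=\frac4\pi$. Moreover $f$ is analytic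 at $0$, with $f'(0)=\frac{32}\pi\ln2$ and $f''(0)=\frac4\pi\left(64\ln^22-3\pi^2\right)$. -/

import Mathlib

noncomputable section

namespace RamanujanExt

/-- The rising factorial `(x)_n = x (x + 1) ⋯ (x + n - 1)` for a natural number `n`. -/
def rising (x : ℂ) (n : ℕ) : ℂ := (ascPochhammer ℂ n).eval x

/-- The rising factorial `(x)_a = Γ(x + a) / Γ(x)` with a complex index `a`. -/
def risingC (x a : ℂ) : ℂ := Complex.Gamma (x + a) / Complex.Gamma x

/-- The `n`-th term of the series of `f(a)`. -/
def fTerm (a : ℂ) (n : ℕ) : ℂ :=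
  1 / 2 ^ (2 * n) * (rising (a + 1 / 2) n ^ 3 / rising (a + 1) n ^ 3) * (6 * (n + a) + 1)

/-- The extended Ramanujan series `f(a)`. -/
def f (a : ℂ) : ℂ := ∑' n : ℕ, fTerm a n

/-- The `n`-th term of the series on the right of the first identity. -/
def term₁ (a : ℂ) (n : ℕ) : ℂ := rising (1 / 2) n ^ 2 / rising (a + 1) n ^ 2

/-- The `n`-th term of the series on the right of the second identity. -/
def term₂ (a : ℂ) (n : ℕ) : ℂ :=
  (rising (1 / 2) n * rising (a + 1 / 2) n) / (rising (a + 1) n * rising (3 / 2 - a) n)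

end RamanujanExt

end

/-! ### Rising factorials, a uniform Raabe test, and holomorphy of hypergeometric sums. -/

namespace RamanujanExt

open Filter Topology Finset

/-! Splitting off the first term of `f` gives `f a = 6 a + 1 + s(a) f (a + 1)`, where `s` is
`shiftFactor`. Both right-hand series satisfy the same recurrence, by WZ-type telescoping
(`term₁_telescope`, `term₂_telescope`), so each identity becomes a uniqueness question for `h a =
s(a) h (a + 1)`.

For the first identity one moves right: `|s| ≤ 1/4` on `Re a ≥ -3/4`, so a solution of linear growth
along `a + n` is zero (`eq_zero_of_functional_equation`).

For the second, the recurrence of the series holds only for `Re a < -1/2`, and the difference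
`resid` is not zero. Multiplied by `4^(-a) (Γ(a+1/2)/Γ(a+1))^3` it becomes invariant under `a ↦ a +
1`; the further factor `cos² πa`, together with the zero of `resid` at `-1/2`, cancels the triple
pole there. The product extends to an entire function of period one. It is `O(|y|² e^{2π|y|})` in
general and `o(e^{2π|y|})` on the imaginary axis, so its Fourier expansion reduces to a constant
(`eq_of_periodic_of_growth`), fixed by `f 0 = 4/π`.

At `a = 1/2` the first series is the sum of inverse odd squares. At `a = 0` the telescoping leaves a
boundary term which Wallis' product evaluates. Near `0` the second identity reads `f = gammaPart +
a² · (holomorphic)`: the derivatives follow from digamma values, the reflection formula, and the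
second series at `0`, which is `π/2`. -/

lemma rising_zero (x : ℂ) : rising x 0 = 1 := by simp [rising]

lemma rising_succ (x : ℂ) (n : ℕ) : rising x (n + 1) = rising x n * (x + n) := by
  simp [rising, ascPochhammer_succ_eval]

lemma mul_rising_add_one (x : ℂ) (n : ℕ) : x * rising (x + 1) n = rising x n * (x + n) := by
  induction n with
  | zero => simp [rising_zero]
  | succ k ih => rw [rising_succ, rising_succ, ← mul_assoc, ih]; push_cast; ring

lemma rising_succ' (x : ℂ) (n : ℕ) : rising x (n + 1) = x * rising (x + 1) n := by
  rw [mul_rising_add_one, rising_succ]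

lemma rising_ne_zero {x : ℂ} (hx : ∀ m : ℕ, x + m ≠ 0) (n : ℕ) : rising x n ≠ 0 := by
  induction n with
  | zero => simp [rising_zero]
  | succ k ih => rw [rising_succ]; exact mul_ne_zero ih (hx k)

lemma add_natCast_ne_zero_of_re_pos {x : ℂ} (hx : 0 < x.re) (m : ℕ) : x + m ≠ 0 := by
  intro h
  have := congrArg Complex.re h
  simp at this
  have := m.cast_nonneg (α := ℝ)
  linarith

lemma add_one_add_natCast_ne_zero {a : ℂ} (ha : ∀ m : ℕ, a ≠ -((m : ℂ) + 1)) (m : ℕ) :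
    a + 1 + m ≠ 0 := fun h => ha m (by linear_combination h)

lemma ne_neg_natCast_add_one_of_re {a : ℂ} (ha : -1 < a.re) (m : ℕ) : a ≠ -((m : ℂ) + 1) := by
  intro h
  have := congrArg Complex.re h
  simp at this
  have := m.cast_nonneg (α := ℝ)
  linarith

lemma differentiable_rising_comp {g : ℂ → ℂ} (hg : Differentiable ℂ g) (n : ℕ) :
    Differentiable ℂ (fun a => rising (g a) n) :=
  (Polynomial.differentiable (ascPochhammer ℂ n)).comp hg

/-- The majorant in the Raabe test. -/
noncomputable def raabe (N : ℕ) (s : ℝ) (n : ℕ) : ℝ := ∏ j ∈ range n, (1 - s / (N + j + 1))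

lemma raabe_succ (N : ℕ) (s : ℝ) (n : ℕ) :
    raabe N s (n + 1) = raabe N s n * (1 - s / (N + n + 1)) := by
  simp [raabe, prod_range_succ]

lemma raabe_nonneg {N : ℕ} {s : ℝ} (hN : s ≤ N + 1) (n : ℕ) : 0 ≤ raabe N s n := by
  refine prod_nonneg fun j _ => ?_
  have : (0 : ℝ) ≤ j := j.cast_nonneg
  have : (0 : ℝ) ≤ N := N.cast_nonneg
  rw [sub_nonneg, div_le_one (by positivity)]
  linarith

lemma summable_raabe {N : ℕ} {s : ℝ} (hs : 1 < s) (hN : s ≤ N + 1) : Summable (raabe N s) := by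
  refine summable_of_sum_range_le (c := N / (s - 1)) (raabe_nonneg hN) fun n => ?_
  -- The majorant telescopes: `(s - 1) r_n = (N + n) r_n - (N + n + 1) r_{n+1}`.
  have key : (s - 1) * ∑ i ∈ range n, raabe N s i = N - (N + n) * raabe N s n := by
    induction n with
    | zero => simp [raabe]
    | succ k ih =>
      rw [sum_range_succ, mul_add, ih, raabe_succ]
      have : (N : ℝ) + k + 1 ≠ 0 := by positivity
      push_cast
      field_simp
      ring
  rw [le_div_iff₀ (by linarith), mul_comm, key]
  have := raabe_nonneg hN n
  have : 0 ≤ (N + n : ℝ) * raabe N s n := by positivity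
  linarith

/-- The imaginary part enters only at second order: `2 (n + Re p) ≥ n`, so `R²/n` more than absorbs
`(Im p)² ≤ R²`. -/
lemma norm_natCast_add_le {R : ℝ} {p : ℂ} (hp : ‖p‖ ≤ R) {n : ℝ} (hn : 2 * R ≤ n) (hn0 : 0 < n) :
    ‖(n : ℂ) + p‖ ≤ n + p.re + R ^ 2 / n := by
  have hre := Complex.abs_re_le_norm p
  have him := Complex.abs_im_le_norm p
  have hR : 0 ≤ R := (norm_nonneg p).trans hp
  have h1 : -R ≤ p.re := by have := neg_abs_le p.re; linarith
  have h2 : p.im ^ 2 ≤ R ^ 2 := by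
    rw [← sq_abs]; exact pow_le_pow_left₀ (abs_nonneg _) (him.trans hp) 2
  have h3 : n / 2 ≤ n + p.re := by linarith
  rw [Complex.norm_def, Complex.normSq_apply]
  apply Real.sqrt_le_iff.2
  have h4 : 0 ≤ R ^ 2 / n := by positivity
  refine ⟨by linarith, ?_⟩
  have h5 : R ^ 2 ≤ 2 * (n + p.re) * (R ^ 2 / n) := by
    calc R ^ 2 = 2 * (n / 2) * (R ^ 2 / n) := by field_simp
      _ ≤ _ := by gcongr
  simp only [Complex.add_re, Complex.ofReal_re, Complex.add_im, Complex.ofReal_im, zero_add]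
  nlinarith

lemma le_norm_natCast_add (p : ℂ) (n : ℝ) : n + p.re ≤ ‖(n : ℂ) + p‖ := by
  simpa using Complex.re_le_norm ((n : ℂ) + p)

/-- The modulus of the ratio is `1 - Re(r + t - p - q)/n + O(1/n²)`, uniformly for parameters in a
disc; the gap `c - s` absorbs the error for large `n`. -/
lemma exists_ratio_bound (R : ℝ) {c s : ℝ} (hR : 0 ≤ R) (hsc : s < c) (hs : 0 ≤ s) :
    ∃ N : ℕ, s ≤ N + 1 ∧ ∀ n : ℕ, N ≤ n → ∀ p q r t : ℂ, ‖p‖ ≤ R → ‖q‖ ≤ R → ‖r‖ ≤ R → ‖t‖ ≤ R →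
      c ≤ (r + t - p - q).re →
      ‖((n : ℂ) + p) * (n + q) / ((n + r) * (n + t))‖ ≤ 1 - s / (n + 1) := by
  -- `K` adds up the bounds `c1`–`c6` and the term `2 R²` below: after clearing denominators the
  -- errors total at most `K n`, against a gain of at least `(c - s) n²`.
  set K : ℝ := 2 * R ^ 2 + (R + 1) ^ 2 + 2 * (R + 1) + (R + 1) ^ 2 + R ^ 2 + 2 * (1 + s) * R
    + (1 + s) * R ^ 2 with hK
  obtain ⟨N, hN⟩ := exists_nat_ge (max (K / (c - s)) (max (2 * R + 1) (max (R ^ 2) s)))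
  simp only [max_le_iff] at hN
  obtain ⟨hN1, hN2, hN3, hN4⟩ := hN
  refine ⟨N, by linarith, fun n hn p q r t hp hq hr ht hc => ?_⟩
  have hnN : (N : ℝ) ≤ n := by exact_mod_cast hn
  have hx : ∀ z : ℂ, ‖z‖ ≤ R → |z.re| ≤ R := fun z hz => (Complex.abs_re_le_norm z).trans hz
  have hp' := abs_le.1 (hx p hp)
  have hq' := abs_le.1 (hx q hq)
  have hr' := abs_le.1 (hx r hr)
  have ht' := abs_le.1 (hx t ht)
  have hn0 : (0 : ℝ) < n := by linarith
  have hp2 := norm_natCast_add_le hp (n := n) (by linarith) hn0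
  have hq2 := norm_natCast_add_le hq (n := n) (by linarith) hn0
  have hr2 := le_norm_natCast_add r n
  have ht2 := le_norm_natCast_add t n
  have hr0 : 0 < (n : ℝ) + r.re := by linarith
  have ht0 : 0 < (n : ℝ) + t.re := by linarith
  simp only [Complex.ofReal_natCast] at hp2 hq2 hr2 ht2
  rw [norm_div, norm_mul, norm_mul, div_le_iff₀ (by
    apply mul_pos <;> linarith)]
  set e : ℝ := R ^ 2 / n with he
  have he0 : 0 ≤ e := by positivity
  have he1 : e ≤ 1 := by rw [he, div_le_one hn0]; linarith
  have hen : e * n = R ^ 2 := by rw [he]; field_simp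
  have hs1 : 0 ≤ 1 - s / (n + 1 : ℝ) := by
    rw [sub_nonneg, div_le_one (by positivity)]; linarith
  have hmain : ((n : ℝ) + p.re + e) * (n + q.re + e) ≤
      (1 - s / (n + 1)) * ((n + r.re) * (n + t.re)) := by
    have : 1 - s / (n + 1 : ℝ) = (n + 1 - s) / (n + 1) := by field_simp
    rw [this, div_mul_eq_mul_div, le_div_iff₀ (by positivity)]
    have hc' : c ≤ r.re + t.re - p.re - q.re := by simpa using hc
    have hKn : K ≤ (c - s) * n := by
      rw [div_le_iff₀ (by linarith)] at hN1
      nlinarith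
    have hKn2 : K * n ≤ (c - s) * n * n := by gcongr
    have hab : ∀ x y : ℝ, |x| ≤ R + 1 → |y| ≤ R + 1 → x * y ≤ (R + 1) ^ 2 := fun x y h1 h2 => by
      calc x * y ≤ |x * y| := le_abs_self _
        _ = |x| * |y| := abs_mul _ _
        _ ≤ (R + 1) * (R + 1) := by gcongr
        _ = _ := by ring
    have b1 := hab (p.re + e) (q.re + e) (abs_le.2 ⟨by linarith, by linarith⟩)
      (abs_le.2 ⟨by linarith, by linarith⟩)
    have b2 : |r.re * t.re| ≤ R ^ 2 := by
      rw [abs_mul, sq]; gcongr; exacts [hx r hr, hx t ht]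
    have b3 : |(1 - s) * (r.re + t.re)| ≤ (1 + s) * (2 * R) := by
      rw [abs_mul]
      gcongr
      · exact abs_le.2 ⟨by linarith, by linarith⟩
      · exact abs_le.2 ⟨by linarith, by linarith⟩
    have b4 : |(1 - s) * (r.re * t.re)| ≤ (1 + s) * R ^ 2 := by
      rw [abs_mul]
      gcongr
      exact abs_le.2 ⟨by linarith, by linarith⟩
    have b2' := (abs_le.1 b2).1
    have b3' := (abs_le.1 b3).1
    have b4' := (abs_le.1 b4).1
    have hn1 : (1 : ℝ) ≤ n := by linarith
    have c1 : n * ((p.re + e) * (q.re + e)) ≤ n * (R + 1) ^ 2 := by gcongr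
    have c2 : n * (-(R ^ 2)) ≤ n * (r.re * t.re) := by gcongr
    have c3 : n * (-((1 + s) * (2 * R))) ≤ n * ((1 - s) * (r.re + t.re)) := by gcongr
    have c4 : n * (p.re + q.re + 2 * e) ≤ n * (2 * (R + 1)) := by gcongr; linarith
    have c5 : (R + 1) ^ 2 ≤ n * (R + 1) ^ 2 := le_mul_of_one_le_left (by positivity) hn1
    have c6 : (1 + s) * R ^ 2 ≤ n * ((1 + s) * R ^ 2) := le_mul_of_one_le_left (by positivity) hn1
    have c7 : (c - s) * n * n ≤ (r.re + t.re - p.re - q.re - s) * n * n := by gcongr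
    have id1 : ((n : ℝ) + p.re + e) * (n + q.re + e) * (n + 1) = n ^ 3 + n ^ 2 * (p.re + q.re + 1)
        + 2 * (e * n) * n + n * ((p.re + e) * (q.re + e)) + n * (p.re + q.re + 2 * e)
        + (p.re + e) * (q.re + e) := by ring
    have id2 : ((n : ℝ) + 1 - s) * ((n + r.re) * (n + t.re)) = n ^ 3
        + n ^ 2 * (p.re + q.re + 1) + (r.re + t.re - p.re - q.re - s) * n * n
        + n * (r.re * t.re) + n * ((1 - s) * (r.re + t.re)) + (1 - s) * (r.re * t.re) := by ring
    rw [id1, id2, hen]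
    have hKn3 : K * n = n * (2 * R ^ 2) + n * (R + 1) ^ 2 + n * (2 * (R + 1)) + n * (R + 1) ^ 2
      + n * R ^ 2 + n * ((1 + s) * (2 * R)) + n * ((1 + s) * R ^ 2) := by rw [hK]; ring
    linarith
  calc _ ≤ ((n : ℝ) + p.re + e) * (n + q.re + e) :=
        mul_le_mul hp2 hq2 (norm_nonneg _) ((norm_nonneg _).trans hp2)
    _ ≤ _ := hmain
    _ ≤ _ := by gcongr

/-- Raabe's test for hypergeometric series, uniformly in the parameters. -/
lemma exists_hypergeometric_majorant {R c : ℝ} (hR : 0 ≤ R) (hc : 1 < c) :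
    ∃ (N : ℕ) (b : ℕ → ℝ), Summable b ∧ ∀ p q r t : ℂ,
      ‖p‖ ≤ R → ‖q‖ ≤ R → ‖r‖ ≤ R → ‖t‖ ≤ R → c ≤ (r + t - p - q).re →
      ∀ T : ℕ → ℂ, (∀ n : ℕ, T (n + 1) = T n * (((n : ℂ) + p) * (n + q) / ((n + r) * (n + t)))) →
      ∀ n, ‖T (N + n)‖ ≤ ‖T N‖ * b n := by
  obtain ⟨s, hs1, hs2⟩ := exists_between hc
  obtain ⟨N, hN, h⟩ := exists_ratio_bound R hR hs2 (by linarith)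
  refine ⟨N, raabe N s, summable_raabe hs1 hN, fun p q r t hp hq hr ht hre T hT n => ?_⟩
  induction n with
  | zero => simp [raabe]
  | succ k ih =>
    rw [← add_assoc, hT, norm_mul, raabe_succ, ← mul_assoc]
    have := h (N + k) (by omega) p q r t hp hq hr ht hre
    push_cast at this ⊢
    exact mul_le_mul ih this (norm_nonneg _) ((norm_nonneg _).trans ih)

lemma summable_norm_of_hypergeometric_ratio {p q r t : ℂ} (h : 1 < (r + t - p - q).re) {T : ℕ → ℂ}
    (hT : ∀ n : ℕ, T (n + 1) = T n * (((n : ℂ) + p) * (n + q) / ((n + r) * (n + t)))) :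
    Summable fun n => ‖T n‖ := by
  obtain ⟨N, b, hb, hbd⟩ := exists_hypergeometric_majorant
    (R := ‖p‖ + ‖q‖ + ‖r‖ + ‖t‖) (by positivity) h
  have hp := norm_nonneg p
  have hq := norm_nonneg q
  have hr := norm_nonneg r
  have ht := norm_nonneg t
  rw [← summable_nat_add_iff N]
  refine Summable.of_nonneg_of_le (fun n => norm_nonneg _) (fun n => ?_) (hb.mul_left ‖T N‖)
  rw [add_comm]
  exact hbd p q r t (by linarith) (by linarith) (by linarith) (by linarith) le_rfl T hT n

/-- Only tails need a majorant, with a starting index depending on the compact set; the finite head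
is added back. -/
lemma differentiableOn_tsum_of_tail_bound {U : Set ℂ} (hU : IsOpen U) {T : ℕ → ℂ → ℂ}
    (hT : ∀ n, DifferentiableOn ℂ (T n) U)
    (h : ∀ K ⊆ U, IsCompact K → ∃ (N : ℕ) (b : ℕ → ℝ), Summable b ∧
      ∀ a ∈ K, ∀ n, ‖T (N + n) a‖ ≤ b n) :
    DifferentiableOn ℂ (fun a => ∑' n, T n a) U := by
  intro a ha
  obtain ⟨ε, hε, hball⟩ := Metric.nhds_basis_closedBall.mem_iff.1 (hU.mem_nhds ha)
  obtain ⟨N, b, hb, hbd⟩ := h _ hball (isCompact_closedBall a ε)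
  have hsub : Metric.ball a ε ⊆ U := Metric.ball_subset_closedBall.trans hball
  have h1 : DifferentiableOn ℂ (fun z => ∑' n, T (N + n) z) (Metric.ball a ε) :=
    Complex.differentiableOn_tsum_of_summable_norm hb (fun n => (hT _).mono hsub)
      Metric.isOpen_ball fun n z hz => hbd z (Metric.ball_subset_closedBall hz) n
  have h2 : DifferentiableOn ℂ (fun z => ∑ n ∈ range N, T n z + ∑' n, T (N + n) z)
      (Metric.ball a ε) :=
    (DifferentiableOn.fun_sum fun n _ => (hT n).mono hsub).add h1
  have hnhds := Metric.ball_mem_nhds a hε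
  refine ((h2.differentiableAt hnhds).congr_of_eventuallyEq ?_).differentiableWithinAt
  filter_upwards [hnhds] with z hz
  have hs : Summable fun n => T (n + N) z := by
    refine Summable.of_norm_bounded hb fun n => ?_
    rw [add_comm]
    exact hbd z (Metric.ball_subset_closedBall hz) n
  rw [← ((summable_nat_add_iff N).1 hs).sum_add_tsum_nat_add N]
  simp_rw [add_comm N]

lemma differentiableOn_tsum_of_hypergeometric_ratio {U : Set ℂ} (hU : IsOpen U) {T : ℕ → ℂ → ℂ}
    (hT : ∀ n, DifferentiableOn ℂ (T n) U) {p q r t : ℂ → ℂ} (hp : ContinuousOn p U)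
    (hq : ContinuousOn q U) (hr : ContinuousOn r U) (ht : ContinuousOn t U)
    (hre : ∀ a ∈ U, 1 < (r a + t a - p a - q a).re)
    (hrec : ∀ a ∈ U, ∀ n : ℕ,
      T (n + 1) a = T n a * (((n : ℂ) + p a) * (n + q a) / ((n + r a) * (n + t a)))) :
    DifferentiableOn ℂ (fun a => ∑' n, T n a) U := by
  refine differentiableOn_tsum_of_tail_bound hU hT fun K hK hKc => ?_
  rcases K.eq_empty_or_nonempty with rfl | hne
  · exact ⟨0, fun _ => 0, summable_zero, by simp⟩
  have hcr : ContinuousOn (fun a => (r a + t a - p a - q a).re) K :=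
    (Complex.continuous_re.comp_continuousOn (((hr.add ht).sub hp).sub hq)).mono hK
  -- The minimum over `K` still exceeds `1`, so a single Raabe exponent serves the whole compact
  -- set.
  obtain ⟨a₀, ha₀, hmin⟩ := hKc.exists_isMinOn hne hcr
  obtain ⟨Rp, hRp⟩ := hKc.exists_bound_of_continuousOn (hp.mono hK)
  obtain ⟨Rq, hRq⟩ := hKc.exists_bound_of_continuousOn (hq.mono hK)
  obtain ⟨Rr, hRr⟩ := hKc.exists_bound_of_continuousOn (hr.mono hK)
  obtain ⟨Rt, hRt⟩ := hKc.exists_bound_of_continuousOn (ht.mono hK)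
  set R := max 0 (max (max Rp Rq) (max Rr Rt)) with hR
  obtain ⟨N, b, hb, hbd⟩ := exists_hypergeometric_majorant (R := R) (le_max_left _ _) (hre a₀ (hK ha₀))
  obtain ⟨M, hM⟩ := hKc.exists_bound_of_continuousOn ((hT N).continuousOn.mono hK)
  refine ⟨N, fun n => M * |b n|, hb.abs.mul_left M, fun a ha n => ?_⟩
  refine (hbd (p a) (q a) (r a) (t a) ((hRp a ha).trans (by simp [hR]))
    ((hRq a ha).trans (by simp [hR])) ((hRr a ha).trans (by simp [hR]))
    ((hRt a ha).trans (by simp [hR])) (hmin ha) (fun n => T n a) (hrec a (hK ha)) n).trans ?_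
  calc ‖T N a‖ * b n ≤ ‖T N a‖ * |b n| := by gcongr; exact le_abs_self _
    _ ≤ M * |b n| := by gcongr; exact hM a ha

end RamanujanExt

/-! ### Telescoping with a linear factor; the functional equation of `f` and uniqueness to the
right. -/

namespace RamanujanExt

open Filter Topology Finset

/-- If `∑ t k` converges absolutely and `(α + β k) t k` converges, its limit is zero. -/
lemma eq_zero_of_tendsto_linear_mul {𝕜 : Type*} [RCLike 𝕜] {t : ℕ → 𝕜} (ht : Summable fun k => ‖t k‖) {α β L : 𝕜}
    (h : Tendsto (fun k : ℕ => (α + β * k) * t k) atTop (𝓝 L)) : L = 0 := by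
  by_contra hL
  have h0 : 0 < ‖L‖ / 2 := by positivity
  have ev : ∀ᶠ k : ℕ in atTop, ‖L‖ / 2 < ‖(α + β * k) * t k‖ :=
    h.norm.eventually_const_lt (by linarith [norm_pos_iff.2 hL])
  -- A nonzero limit would force `‖t k‖` to be at least a multiple of `1/k`.
  apply Real.not_summable_one_div_natCast
  refine summable_of_isBigO_nat ht (Asymptotics.IsBigO.of_bound ((‖α‖ + ‖β‖) / (‖L‖ / 2)) ?_)
  filter_upwards [ev, eventually_ge_atTop 1] with k hk hk1
  have hk1' : (1 : ℝ) ≤ k := by exact_mod_cast hk1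
  rw [norm_mul] at hk
  have h1 : ‖α + β * k‖ ≤ (‖α‖ + ‖β‖) * k := by
    calc ‖α + β * k‖ ≤ ‖α‖ + ‖β‖ * k := by simpa using norm_add_le α (β * k)
      _ ≤ ‖α‖ * k + ‖β‖ * k := by
        have := le_mul_of_one_le_right (norm_nonneg α) hk1'
        linarith
      _ = _ := by ring
  have h2 : ‖α + β * k‖ * ‖t k‖ ≤ (‖α‖ + ‖β‖) * k * ‖t k‖ := by gcongr
  rw [norm_norm, Real.norm_of_nonneg (by positivity), div_mul_eq_mul_div, div_le_div_iff₀ (by linarith) h0]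
  nlinarith

lemma tsum_telescope_linear_mul {𝕜 : Type*} [RCLike 𝕜] {t d : ℕ → 𝕜} (ht : Summable fun k => ‖t k‖) {α β : 𝕜}
    (hd : Summable d)
    (h : ∀ k : ℕ, d k = (α + β * k) * t k - (α + β * (k + 1 : ℕ)) * t (k + 1)) :
    ∑' k, d k = α * t 0 := by
  have h1 : ∀ n : ℕ, ∑ k ∈ range n, d k = α * t 0 - (α + β * n) * t n := by
    intro n
    induction n with
    | zero => simp
    | succ n ih => rw [sum_range_succ, ih, h]; ring
  have h2 := hd.hasSum.tendsto_sum_nat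
  simp_rw [h1] at h2
  have h3 : Tendsto (fun k : ℕ => (α + β * k) * t k) atTop (𝓝 (α * t 0 - ∑' k, d k)) := by
    have := h2.const_sub (α * t 0)
    simpa using this
  have := eq_zero_of_tendsto_linear_mul ht h3
  linear_combination -this

/-- The multiplier of the functional equation of `f`. -/
noncomputable def shiftFactor (a : ℂ) : ℂ := (a + 1 / 2) ^ 3 / (4 * (a + 1) ^ 3)

lemma fTerm_zero (a : ℂ) : fTerm a 0 = 6 * a + 1 := by simp [fTerm, rising_zero]

lemma fTerm_succ (a : ℂ) (n : ℕ) : fTerm a (n + 1) = shiftFactor a * fTerm (a + 1) n := by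
  rw [fTerm, fTerm, rising_succ', rising_succ', shiftFactor,
    show a + 1 / 2 + 1 = a + 1 + 1 / 2 by ring]
  have : (2 : ℂ) ^ (2 * (n + 1)) = 4 * 2 ^ (2 * n) := by
    rw [mul_add, pow_add]; norm_num; ring
  rw [this, mul_pow, mul_pow]
  push_cast
  simp only [div_eq_mul_inv, mul_inv]
  ring

lemma fTerm_succ_eq_mul {a : ℂ} {n : ℕ} (h : 6 * (n + a) + 1 ≠ 0) :
    fTerm a (n + 1) = fTerm a n * (1 / 4 * ((a + n + 1 / 2) / (a + n + 1)) ^ 3 *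
      ((6 * (n + 1 + a) + 1) / (6 * (n + a) + 1))) := by
  rw [fTerm, fTerm, rising_succ, rising_succ]
  have : (2 : ℂ) ^ (2 * (n + 1)) = 4 * 2 ^ (2 * n) := by
    rw [mul_add, pow_add]; norm_num; ring
  rw [this]
  push_cast
  simp only [div_eq_mul_inv, mul_inv, mul_pow]
  rw [show a + 1 * 2⁻¹ + n = a + n + 1 * 2⁻¹ by ring, show a + 1 + (n : ℂ) = a + n + 1 by ring]
  field_simp

lemma tendsto_natCast_add_div (p q : ℂ) :
    Tendsto (fun n : ℕ => ((n : ℂ) + p) / (n + q)) atTop (𝓝 1) := by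
  have h : ∀ z : ℂ, Tendsto (fun n : ℕ => 1 + z / (n : ℂ)) atTop (𝓝 1) := fun z => by
    have := (tendsto_const_div_atTop_nhds_zero_nat z).const_add 1
    simpa using this
  have h2 := (h p).div (h q) one_ne_zero
  rw [div_one] at h2
  refine h2.congr' ?_
  filter_upwards [eventually_gt_atTop 0] with n hn
  have hn' : (n : ℂ) ≠ 0 := by exact_mod_cast hn.ne'
  simp only [Pi.div_apply]
  rw [← mul_div_mul_left _ _ hn']
  congr 1 <;> field_simp

/-- The term ratio tends to `1/4`. No exclusion of negative integers is needed: there division by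
zero makes all late terms `0`. -/
lemma summable_fTerm (a : ℂ) : Summable (fTerm a) := by
  have hlim : Tendsto (fun n : ℕ => 1 / 4 * ((a + n + 1 / 2) / (a + n + 1)) ^ 3 *
      ((6 * (n + 1 + a) + 1) / (6 * (n + a) + 1))) atTop (𝓝 (1 / 4 * 1 ^ 3 * 1)) := by
    refine Tendsto.mul (Tendsto.const_mul _ (Tendsto.pow ?_ 3)) ?_
    · refine (tendsto_natCast_add_div (a + 1 / 2) (a + 1)).congr fun n => ?_
      congr 1 <;> ring
    · refine (tendsto_natCast_add_div (1 + a + 1 / 6) (a + 1 / 6)).congr fun n => ?_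
      rw [← mul_div_mul_left _ _ (show (6 : ℂ) ≠ 0 by norm_num)]
      congr 1 <;> ring
  have hev : ∀ᶠ n : ℕ in atTop, 6 * ((n : ℂ) + a) + 1 ≠ 0 := by
    obtain ⟨N, hN⟩ := exists_nat_gt ‖a + 1 / 6‖
    filter_upwards [eventually_ge_atTop N] with n hn h
    have h1 : (n : ℂ) = -(a + 1 / 6) := by linear_combination h / 6
    have h2 := congrArg norm h1
    rw [norm_neg, Complex.norm_natCast] at h2
    have : (N : ℝ) ≤ n := by exact_mod_cast hn
    linarith
  have hb : ∀ᶠ n : ℕ in atTop, ‖1 / 4 * ((a + n + 1 / 2) / (a + n + 1)) ^ 3 *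
      ((6 * (n + 1 + a) + 1) / (6 * (n + a) + 1))‖ < 1 / 2 := by
    refine hlim.norm.eventually_lt_const ?_
    norm_num
  refine summable_of_ratio_norm_eventually_le (r := 1 / 2) (by norm_num) ?_
  filter_upwards [hev, hb] with n h1 h2
  rw [fTerm_succ_eq_mul h1, norm_mul, mul_comm]
  gcongr

lemma f_eq (a : ℂ) : f a = 6 * a + 1 + shiftFactor a * f (a + 1) := by
  rw [f, (summable_fTerm a).tsum_eq_zero_add, fTerm_zero, f, ← tsum_mul_left]
  simp_rw [fTerm_succ]

/-- The squared norms differ by `(y - x)(2 Re z + x + y)`. -/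
lemma norm_add_le_norm_add {z : ℂ} {x y : ℝ} (hxy : x ≤ y) (h : 0 ≤ 2 * z.re + x + y) :
    ‖z + x‖ ≤ ‖z + y‖ := by
  rw [Complex.norm_def, Complex.norm_def]
  apply Real.sqrt_le_sqrt
  simp only [Complex.normSq_apply, Complex.add_re, Complex.add_im, Complex.ofReal_re,
    Complex.ofReal_im, add_zero]
  nlinarith

/-- The line `Re a = -3/4` is equidistant from `-1/2` and `-1`; to its right every factor on the
left is the smaller one. -/
lemma norm_rising_le {a : ℂ} (ha : -(3 / 4) ≤ a.re) (n : ℕ) :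
    ‖rising (a + 1 / 2) n‖ ≤ ‖rising (a + 1) n‖ := by
  induction n with
  | zero => simp [rising_zero]
  | succ k ih =>
    rw [rising_succ, rising_succ, norm_mul, norm_mul]
    have hk : (0 : ℝ) ≤ k := k.cast_nonneg
    have := norm_add_le_norm_add (z := a + k) (x := 1 / 2) (y := 1) (by norm_num)
      (by simp; linarith)
    push_cast at this
    rw [show a + 1 / 2 + (k : ℂ) = a + k + 1 / 2 by ring, show a + 1 + (k : ℂ) = a + k + 1 by ring]
    gcongr

lemma norm_fTerm_le {a : ℂ} (ha : -(3 / 4) ≤ a.re) (n : ℕ) :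
    ‖fTerm a n‖ ≤ (1 / 4) ^ n * (6 * (n + ‖a‖) + 1) := by
  rw [fTerm, norm_mul, norm_mul, ← div_pow, norm_pow, norm_div (rising _ _)]
  have h1 : (‖rising (a + 1 / 2) n‖ / ‖rising (a + 1) n‖) ^ 3 ≤ 1 := by
    refine pow_le_one₀ (by positivity) (div_le_one_of_le₀ (norm_rising_le ha n) (norm_nonneg _))
  have h2 : ‖(1 : ℂ) / 2 ^ (2 * n)‖ = (1 / 4) ^ n := by
    rw [pow_mul]; simp; norm_num
  have h3 : ‖6 * ((n : ℂ) + a) + 1‖ ≤ 6 * (n + ‖a‖) + 1 := by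
    calc ‖6 * ((n : ℂ) + a) + 1‖ ≤ ‖6 * ((n : ℂ) + a)‖ + ‖(1 : ℂ)‖ := norm_add_le _ _
      _ ≤ _ := by
        rw [norm_mul]; simp only [norm_one, RCLike.norm_ofNat]
        gcongr
        simpa using norm_add_le (n : ℂ) a
  rw [h2]
  calc _ ≤ (1 / 4 : ℝ) ^ n * 1 * (6 * (n + ‖a‖) + 1) := by gcongr
    _ = _ := by ring

lemma summable_fTerm_majorant (R : ℝ) :
    Summable fun n : ℕ => (1 / 4 : ℝ) ^ n * (6 * (n + R) + 1) := by
  have h1 : Summable fun n : ℕ => ((n : ℝ) ^ 1) * (1 / 4 : ℝ) ^ n :=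
    summable_pow_mul_geometric_of_norm_lt_one 1 (by norm_num)
  have h2 : Summable fun n : ℕ => (1 / 4 : ℝ) ^ n :=
    summable_geometric_of_lt_one (by norm_num) (by norm_num)
  exact ((h1.mul_left 6).add (h2.mul_left (6 * R + 1))).congr fun n => by ring

lemma exists_norm_f_le : ∃ C : ℝ, 0 ≤ C ∧ ∀ a : ℂ, -(3 / 4) ≤ a.re → ‖f a‖ ≤ C * (1 + ‖a‖) := by
  have h0 := summable_fTerm_majorant 0
  have h2 : Summable fun n : ℕ => (1 / 4 : ℝ) ^ n :=
    summable_geometric_of_lt_one (by norm_num) (by norm_num)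
  set A := ∑' n : ℕ, (1 / 4 : ℝ) ^ n * (6 * (n + 0) + 1)
  have hA : 0 ≤ A := tsum_nonneg fun n => by positivity
  set B := ∑' n : ℕ, (1 / 4 : ℝ) ^ n
  have hB : 0 ≤ B := tsum_nonneg fun n => by positivity
  refine ⟨A + 6 * B, by positivity, fun a ha => ?_⟩
  have h3 : ‖f a‖ ≤ A + 6 * ‖a‖ * B := by
    refine tsum_of_norm_bounded (h0.hasSum.add (h2.hasSum.mul_left (6 * ‖a‖))) fun n => ?_
    refine (norm_fTerm_le ha n).trans_eq ?_
    ring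
  have := norm_nonneg a
  nlinarith [mul_nonneg hA this]

lemma differentiableOn_f : DifferentiableOn ℂ f {a | -(3 / 4) < a.re} := by
  refine differentiableOn_tsum_of_tail_bound (isOpen_lt continuous_const Complex.continuous_re)
    (fun n => ?_) fun K hK hKc => ?_
  · intro a ha
    have h := rising_ne_zero (x := a + 1)
      (add_natCast_ne_zero_of_re_pos (by simp at ha ⊢; linarith)) n
    have h2 := differentiable_rising_comp (g := fun a => a + 1 / 2) (by fun_prop) n
    have h3 := differentiable_rising_comp (g := fun a => a + 1) (by fun_prop) n
    unfold fTerm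
    refine DifferentiableAt.differentiableWithinAt ?_
    fun_prop (disch := exact pow_ne_zero _ h)
  · obtain ⟨R, hR⟩ := hKc.exists_bound_of_continuousOn continuousOn_id
    refine ⟨0, _, summable_fTerm_majorant R, fun a ha n => ?_⟩
    rw [zero_add]
    refine (norm_fTerm_le (le_of_lt (hK ha)) n).trans ?_
    have : ‖a‖ ≤ R := hR a ha
    gcongr

lemma norm_shiftFactor_le {a : ℂ} (ha : -(3 / 4) ≤ a.re) : ‖shiftFactor a‖ ≤ 1 / 4 := by
  have h := norm_add_le_norm_add (z := a) (x := 1 / 2) (y := 1) (by norm_num) (by linarith)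
  push_cast at h
  rw [shiftFactor, norm_div, norm_mul, norm_pow, norm_pow]
  simp only [RCLike.norm_ofNat]
  have h0 : 0 < ‖a + 1‖ := by
    have := Complex.re_le_norm (a + 1)
    simp at this; linarith
  rw [div_le_iff₀ (by positivity)]
  have := pow_le_pow_left₀ (norm_nonneg _) h 3
  linarith

/-- A solution of the homogeneous functional equation of linear growth vanishes. -/
lemma eq_zero_of_functional_equation {h : ℂ → ℂ} {C : ℝ} (hC : 0 ≤ C) {a : ℂ}
    (hfe : ∀ n : ℕ, h (a + n) = shiftFactor (a + n) * h (a + (n + 1 : ℕ)))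
    (hb : ∀ n : ℕ, ‖h (a + n)‖ ≤ C * (1 + ‖a + n‖)) (ha : -(3 / 4) ≤ a.re) : h a = 0 := by
  -- Each step to the right gains a factor `1/4`, which beats linear growth.
  have h1 : ∀ n : ℕ, ‖h a‖ ≤ (1 / 4) ^ n * ‖h (a + n)‖ := by
    intro n
    induction n with
    | zero => simp
    | succ n ih =>
      have hn : (0 : ℝ) ≤ n := n.cast_nonneg
      have h2 : ‖h (a + n)‖ ≤ 1 / 4 * ‖h (a + (n + 1 : ℕ))‖ := by
        rw [hfe, norm_mul]
        gcongr
        exact norm_shiftFactor_le (by simp; linarith)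
      calc ‖h a‖ ≤ (1 / 4) ^ n * ‖h (a + n)‖ := ih
        _ ≤ (1 / 4) ^ n * (1 / 4 * ‖h (a + (n + 1 : ℕ))‖) := by gcongr
        _ = _ := by ring
  have h3 : ∀ n : ℕ, ‖h a‖ ≤ C * ((1 / 4) ^ n * (6 * (n + ‖a‖) + 1)) := fun n => by
    calc ‖h a‖ ≤ (1 / 4) ^ n * ‖h (a + n)‖ := h1 n
      _ ≤ (1 / 4) ^ n * (C * (1 + ‖a + n‖)) := by gcongr; exact hb n
      _ ≤ (1 / 4) ^ n * (C * (6 * (n + ‖a‖) + 1)) := by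
        have h5 := norm_add_le a n
        rw [Complex.norm_natCast] at h5
        have h6 := norm_nonneg a
        have h7 := n.cast_nonneg (α := ℝ)
        have h8 : 1 + ‖a + n‖ ≤ 6 * (n + ‖a‖) + 1 := by linarith
        gcongr
      _ = _ := by ring
  have h4 := ((summable_fTerm_majorant ‖a‖).tendsto_atTop_zero).const_mul C
  rw [mul_zero] at h4
  exact norm_le_zero_iff.1 (ge_of_tendsto' h4 h3)

end RamanujanExt

/-! ### The first identity. -/

namespace RamanujanExt

open Filter Topology Finset

lemma term₁_zero (a : ℂ) : term₁ a 0 = 1 := by simp [term₁, rising_zero]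

lemma term₁_succ (a : ℂ) (n : ℕ) :
    term₁ a (n + 1) =
      term₁ a n * (((n : ℂ) + 1 / 2) * (n + 1 / 2) / ((n + (a + 1)) * (n + (a + 1)))) := by
  rw [term₁, term₁, rising_succ, rising_succ, div_mul_div_comm]
  congr 1 <;> ring

lemma summable_norm_term₁ {a : ℂ} (ha : 0 < a.re) : Summable fun n => ‖term₁ a n‖ :=
  summable_norm_of_hypergeometric_ratio (by norm_num; linarith) (term₁_succ a)

lemma rising_add_two_eq {a : ℂ} (ha : a + 1 ≠ 0) (n : ℕ) :
    rising (a + 1 + 1) n = rising (a + 1) n * (a + 1 + n) / (a + 1) := by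
  rw [eq_div_iff ha, mul_comm, mul_rising_add_one]

/-- A WZ-type certificate: divided by `term₁ a k`, it is an identity of rational functions of `a`
and `k`. The linear factor at `k = 0` is the inhomogeneity `6 a + 1` of the functional equation. -/
lemma term₁_telescope {a : ℂ} (ha : ∀ m : ℕ, a + 1 + m ≠ 0) (k : ℕ) :
    8 * a * term₁ a k - shiftFactor a * (8 * (a + 1) * term₁ (a + 1) k) =
      (6 * a + 1 + 4 * k) * term₁ a k - (6 * a + 1 + 4 * (k + 1 : ℕ)) * term₁ a (k + 1) := by
  have h0 : a + 1 ≠ 0 := by simpa using ha 0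
  have hk := ha k
  have hr := rising_ne_zero ha k
  have h1 : term₁ (a + 1) k = term₁ a k * ((a + 1) / (a + 1 + k)) ^ 2 := by
    rw [term₁, term₁, rising_add_two_eq h0]
    field_simp
  rw [h1, term₁_succ, shiftFactor, show (k : ℂ) + (a + 1) = a + 1 + k by ring]
  push_cast
  generalize term₁ a k = t
  field_simp
  ring

/-- The right-hand side of the first identity. -/
noncomputable def rhs₁ (a : ℂ) : ℂ := 8 * a * ∑' n : ℕ, term₁ a n

lemma rhs₁_eq {a : ℂ} (ha : 0 < a.re) : rhs₁ a = 6 * a + 1 + shiftFactor a * rhs₁ (a + 1) := by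
  have hs := (summable_norm_term₁ ha).of_norm
  have hs' := (summable_norm_term₁ (a := a + 1) (by simp; linarith)).of_norm
  have hs1 := hs.mul_left (8 * a)
  have hs2 := (hs'.mul_left (8 * (a + 1))).mul_left (shiftFactor a)
  have h := tsum_telescope_linear_mul (summable_norm_term₁ ha) (hs1.sub hs2)
    (term₁_telescope (add_natCast_ne_zero_of_re_pos (by simp; linarith)))
  rw [hs1.tsum_sub hs2, tsum_mul_left, tsum_mul_left, tsum_mul_left, term₁_zero] at h
  rw [rhs₁, rhs₁]
  linear_combination h

lemma norm_rising_le_of_re_le {a b : ℂ} (hb : 0 ≤ b.re) (hba : (b.re : ℂ) = b)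
    (h : b.re ≤ a.re) (n : ℕ) : ‖rising b n‖ ≤ ‖rising a n‖ := by
  induction n with
  | zero => simp [rising_zero]
  | succ k ih =>
    rw [rising_succ, rising_succ, norm_mul, norm_mul]
    have hk : (0 : ℝ) ≤ k := k.cast_nonneg
    have h1 : ‖b + k‖ ≤ ‖a + k‖ := by
      have h2 := Complex.re_le_norm (a + k)
      rw [← hba, ← Complex.ofReal_natCast, ← Complex.ofReal_add, Complex.norm_real,
        Real.norm_of_nonneg (by positivity)]
      simp at h2 ⊢
      linarith
    gcongr

/-- For `Re a ≥ σ` the terms are dominated by those at the real point `σ`, so the series is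
uniformly bounded and only the prefactor `8 a` grows. -/
lemma norm_rhs₁_le {σ : ℝ} (hσ : 0 < σ) :
    ∃ C : ℝ, 0 ≤ C ∧ ∀ a : ℂ, σ ≤ a.re → ‖rhs₁ a‖ ≤ C * (1 + ‖a‖) := by
  have hs := summable_norm_term₁ (a := σ) (by simpa using hσ)
  have hC : 0 ≤ ∑' n, ‖term₁ σ n‖ := tsum_nonneg fun n => norm_nonneg _
  refine ⟨8 * ∑' n, ‖term₁ σ n‖, by positivity, fun a ha => ?_⟩
  have h1 : ‖∑' n, term₁ a n‖ ≤ ∑' n, ‖term₁ σ n‖ := by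
    refine tsum_of_norm_bounded hs.hasSum fun n => ?_
    have h2 := norm_rising_le_of_re_le (a := a + 1) (b := (σ : ℂ) + 1) (by simp; linarith)
      (by simp) (by simpa using ha) n
    have h3 := rising_ne_zero (x := (σ : ℂ) + 1)
      (add_natCast_ne_zero_of_re_pos (by simp; linarith)) n
    have h4 : 0 < ‖rising ((σ : ℂ) + 1) n‖ := norm_pos_iff.2 h3
    rw [term₁, term₁, norm_div, norm_div, norm_pow, norm_pow, norm_pow]
    gcongr
  rw [rhs₁, norm_mul, norm_mul]
  simp only [RCLike.norm_ofNat]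
  have := norm_nonneg a
  calc 8 * ‖a‖ * ‖∑' n, term₁ a n‖ ≤ 8 * ‖a‖ * ∑' n, ‖term₁ σ n‖ := by gcongr
    _ ≤ _ := by nlinarith

theorem f_eq_rhs₁ {a : ℂ} (ha : 0 < a.re) : f a = rhs₁ a := by
  obtain ⟨C₁, hC₁, h₁⟩ := exists_norm_f_le
  obtain ⟨C₂, hC₂, h₂⟩ := norm_rhs₁_le ha
  refine sub_eq_zero.1 (eq_zero_of_functional_equation (h := fun z => f z - rhs₁ z)
    (C := C₁ + C₂) (by positivity) (fun n => ?_) (fun n => ?_) (by linarith))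
  · have hn : (0 : ℝ) ≤ n := n.cast_nonneg
    rw [f_eq, rhs₁_eq (a := a + n) (by simp; linarith)]
    push_cast
    rw [show a + ((n : ℂ) + 1) = a + n + 1 by ring]
    ring
  · have hn : (0 : ℝ) ≤ n := n.cast_nonneg
    calc ‖f (a + n) - rhs₁ (a + n)‖ ≤ ‖f (a + n)‖ + ‖rhs₁ (a + n)‖ := norm_sub_le _ _
      _ ≤ C₁ * (1 + ‖a + n‖) + C₂ * (1 + ‖a + n‖) :=
        add_le_add (h₁ _ (by simp; linarith)) (h₂ _ (by simp))
      _ = _ := by ring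

/-! ### The values at `1/2` and `0`. -/

lemma rising_half_div_rising_three_halves (n : ℕ) :
    rising (1 / 2) n = rising (3 / 2) n * (1 / (2 * n + 1)) := by
  have h := mul_rising_add_one (1 / 2) n
  have h2 : (2 * (n : ℂ) + 1) ≠ 0 := by exact_mod_cast (by positivity : (2 * n + 1 : ℕ) ≠ 0)
  rw [show (1 : ℂ) / 2 + 1 = 3 / 2 by norm_num] at h
  field_simp
  linear_combination -2 * h

lemma hasSum_one_div_odd_sq : HasSum (fun n : ℕ => 1 / (2 * (n : ℝ) + 1) ^ 2) (Real.pi ^ 2 / 8) := by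
  have h := hasSum_zeta_two
  have heven : HasSum (fun n : ℕ => 1 / ((2 * n : ℕ) : ℝ) ^ 2) (1 / 4 * (Real.pi ^ 2 / 6)) := by
    have he : (fun n : ℕ => 1 / ((2 * n : ℕ) : ℝ) ^ 2) = fun n : ℕ => 1 / 4 * (1 / (n : ℝ) ^ 2) := by
      funext n
      push_cast
      ring
    rw [he]
    exact h.mul_left _
  have hodd : Summable (fun n : ℕ => 1 / ((2 * n + 1 : ℕ) : ℝ) ^ 2) :=
    h.summable.comp_injective (i := fun n : ℕ => 2 * n + 1) fun a b hab => by
      have : 2 * a + 1 = 2 * b + 1 := hab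
      omega
  have h2 := HasSum.even_add_odd (f := fun n : ℕ => 1 / (n : ℝ) ^ 2) heven hodd.hasSum
  have h3 := h2.unique h
  have h4 : ∑' n : ℕ, 1 / ((2 * n + 1 : ℕ) : ℝ) ^ 2 = Real.pi ^ 2 / 8 := by linarith
  have h5 := hodd.hasSum
  rw [h4] at h5
  simpa using h5

lemma f_half : f (1 / 2) = (Real.pi : ℂ) ^ 2 / 2 := by
  rw [f_eq_rhs₁ (by norm_num), rhs₁]
  have h : ∀ n : ℕ, term₁ (1 / 2) n = ((1 / (2 * (n : ℝ) + 1) ^ 2 : ℝ) : ℂ) := fun n => by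
    rw [term₁, show (1 : ℂ) / 2 + 1 = 3 / 2 by norm_num, rising_half_div_rising_three_halves]
    have := rising_ne_zero (x := 3 / 2) (add_natCast_ne_zero_of_re_pos (by norm_num)) n
    push_cast
    field_simp
  simp_rw [h]
  rw [(Complex.hasSum_ofReal.2 hasSum_one_div_odd_sq).tsum_eq]
  push_cast
  ring

lemma wallis_eq (n : ℕ) :
    (Real.Wallis.W n : ℂ) = rising 1 n ^ 2 / (rising (1 / 2) n * rising (3 / 2) n) := by
  induction n with
  | zero => simp [Real.Wallis.W, rising_zero]
  | succ k ih =>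
    have h1 := rising_ne_zero (x := 3 / 2) (add_natCast_ne_zero_of_re_pos (by norm_num)) k
    have h2 := rising_ne_zero (x := 1 / 2) (add_natCast_ne_zero_of_re_pos (by norm_num)) k
    have h3 : (2 * (k : ℂ) + 1) ≠ 0 := by exact_mod_cast (by positivity : (2 * k + 1 : ℕ) ≠ 0)
    have h4 : (2 * (k : ℂ) + 3) ≠ 0 := by exact_mod_cast (by positivity : (2 * k + 3 : ℕ) ≠ 0)
    rw [Real.Wallis.W_succ]
    push_cast
    rw [ih, rising_succ, rising_succ, rising_succ,
      show (1 : ℂ) / 2 + k = (2 * k + 1) / 2 by ring, show (3 : ℂ) / 2 + k = (2 * k + 3) / 2 by ring]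
    field_simp
    ring

lemma tendsto_wallis : Tendsto (fun n => (Real.Wallis.W n : ℂ)) atTop (𝓝 (Real.pi / 2)) := by
  have h : ((Real.pi / 2 : ℝ) : ℂ) = Real.pi / 2 := by push_cast; rfl
  rw [← h]
  exact (Complex.continuous_ofReal.tendsto _).comp Real.tendsto_prod_pi_div_two

/-- The first identity is available at `1`, and one step of the functional equation leads to `0`. -/
lemma f_zero : f 0 = 4 / (Real.pi : ℂ) := by
  have hpi : (Real.pi : ℂ) ≠ 0 := Complex.ofReal_ne_zero.2 Real.pi_ne_zero
  have h1 := f_eq_rhs₁ (a := 1) (by norm_num)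
  rw [f_eq, zero_add, h1, rhs₁]
  have hs := (summable_norm_term₁ (a := 1) (by norm_num)).of_norm
  have hs2 := ((hs.mul_left (8 * 1)).mul_left (shiftFactor 0)).hasSum.tendsto_sum_nat
  -- At `a = 0` the factor `8 a` removes one side of the certificate. Here `term₁ 0 n` decays only
  -- like `1/n`, so the boundary term survives in the limit.
  have hsum : ∀ n : ℕ, ∑ k ∈ range n, shiftFactor 0 * (8 * 1 * term₁ 1 k) =
      (4 * n + 1) * term₁ 0 n - 1 := by
    intro n
    induction n with
    | zero => simp [term₁_zero]
    | succ n ih =>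
      have h := term₁_telescope (a := 0) (add_natCast_ne_zero_of_re_pos (by norm_num)) n
      rw [sum_range_succ, ih]
      push_cast at h ⊢
      rw [zero_add] at h
      linear_combination -h
  have hW : ∀ n : ℕ, (4 * n + 1) * term₁ 0 n - 1 =
      (2 - ((2 * n + 1 : ℕ) : ℂ)⁻¹) * (Real.Wallis.W n : ℂ)⁻¹ - 1 := fun n => by
    have h2 : (2 * (n : ℂ) + 1) ≠ 0 := by exact_mod_cast (by positivity : (2 * n + 1 : ℕ) ≠ 0)
    have h3 := rising_ne_zero (x := 3 / 2) (add_natCast_ne_zero_of_re_pos (by norm_num)) n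
    have h4 := rising_ne_zero (x := 1) (add_natCast_ne_zero_of_re_pos (by norm_num)) n
    rw [term₁, wallis_eq, zero_add, rising_half_div_rising_three_halves]
    obtain ⟨y, hy⟩ : ∃ y : ℂ, y = 2 * n + 1 := ⟨_, rfl⟩
    have hn : (n : ℂ) = (y - 1) / 2 := by rw [hy]; ring
    push_cast
    rw [← hy, hn]
    rw [← hy] at h2
    field_simp
    ring
  have hlim : Tendsto (fun n : ℕ => (2 - ((2 * n + 1 : ℕ) : ℂ)⁻¹) * (Real.Wallis.W n : ℂ)⁻¹ - 1)
      atTop (𝓝 ((2 - 0) * ((Real.pi : ℂ) / 2)⁻¹ - 1)) := by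
    refine Tendsto.sub_const (Tendsto.mul (Tendsto.const_sub _ ?_)
      (tendsto_wallis.inv₀ (by simp [hpi]))) 1
    exact (tendsto_inv_atTop_nhds_zero_nat (𝕜 := ℂ)).comp
      (tendsto_atTop_mono (fun n => (by omega : n ≤ 2 * n + 1)) tendsto_id)
  simp_rw [hsum, hW] at hs2
  have := tendsto_nhds_unique hs2 hlim
  rw [tsum_mul_left, tsum_mul_left] at this
  rw [this]
  field_simp
  ring

end RamanujanExt

/-! ### The second series: its recurrence, and bounds on the residual. -/

namespace RamanujanExt

open Filter Topology Finset

lemma term₂_zero (a : ℂ) : term₂ a 0 = 1 := by simp [term₂, rising_zero]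

lemma term₂_succ (a : ℂ) (n : ℕ) :
    term₂ a (n + 1) =
      term₂ a n * (((n : ℂ) + 1 / 2) * (n + (a + 1 / 2)) / ((n + (a + 1)) * (n + (3 / 2 - a)))) := by
  rw [term₂, term₂, rising_succ, rising_succ, rising_succ, rising_succ, div_mul_div_comm]
  congr 1 <;> ring

lemma summable_norm_term₂ {a : ℂ} (ha : a.re < 1 / 2) : Summable fun n => ‖term₂ a n‖ :=
  summable_norm_of_hypergeometric_ratio (by norm_num; linarith) (term₂_succ a)

/-- The hypergeometric term of the certificate for the second series. -/
noncomputable def certTerm (a : ℂ) (n : ℕ) : ℂ :=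
  (rising (1 / 2) n * rising (a + 1 / 2) n) / (rising (a + 1) n * rising (1 / 2 - a) n)

lemma certTerm_zero (a : ℂ) : certTerm a 0 = 1 := by simp [certTerm, rising_zero]

lemma certTerm_succ (a : ℂ) (n : ℕ) :
    certTerm a (n + 1) = certTerm a n *
      (((n : ℂ) + 1 / 2) * (n + (a + 1 / 2)) / ((n + (a + 1)) * (n + (1 / 2 - a)))) := by
  rw [certTerm, certTerm, rising_succ, rising_succ, rising_succ, rising_succ, div_mul_div_comm]
  congr 1 <;> ring

lemma summable_norm_certTerm {a : ℂ} (ha : a.re < -(1 / 2)) : Summable fun n => ‖certTerm a n‖ :=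
  summable_norm_of_hypergeometric_ratio (by norm_num; linarith) (certTerm_succ a)

/-- Again a rational identity after division by `certTerm a k`. The certificate carries `(1/2 -
a)_k` where `term₂` has `(3/2 - a)_k`, so it decays one power more slowly; its absolute summability
is what restricts the recurrence to `Re a < -1/2`. -/
lemma term₂_telescope {a : ℂ} (hre : a.re < -(1 / 2)) (ha : ∀ m : ℕ, a + 1 + m ≠ 0) (k : ℕ) :
    16 * a ^ 2 / (2 * a - 1) * term₂ a k -
        shiftFactor a * (16 * (a + 1) ^ 2 / (2 * (a + 1) - 1) * term₂ (a + 1) k) =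
      (6 * a + 1 + 2 * k) * certTerm a k - (6 * a + 1 + 2 * (k + 1 : ℕ)) * certTerm a (k + 1) := by
  have h0 : a + 1 ≠ 0 := by simpa using ha 0
  have hk := ha k
  have hr := rising_ne_zero ha k
  have hb : ∀ m : ℕ, 1 / 2 - a + m ≠ 0 :=
    add_natCast_ne_zero_of_re_pos (by norm_num; linarith)
  have hr2 := rising_ne_zero hb k
  have hbk := hb k
  have hb0 : 1 / 2 - a ≠ 0 := by simpa using hb 0
  have hc : a + 1 / 2 ≠ 0 := by
    intro h
    have := congrArg Complex.re h
    norm_num at this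
    linarith
  have e1 : rising (3 / 2 - a) k = rising (1 / 2 - a) k * (1 / 2 - a + k) / (1 / 2 - a) := by
    rw [eq_div_iff hb0, mul_comm, ← mul_rising_add_one]
    ring_nf
  have e2 : rising (a + 1 + 1 / 2) k = rising (a + 1 / 2) k * (a + 1 / 2 + k) / (a + 1 / 2) := by
    rw [eq_div_iff hc, mul_comm, ← mul_rising_add_one]
    ring_nf
  have h1 : term₂ a k = certTerm a k * ((1 / 2 - a) / (1 / 2 - a + k)) := by
    rw [term₂, certTerm, e1]
    generalize 1 / 2 - a + k = x at *
    generalize 1 / 2 - a = y at *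
    field_simp
  have h2 : term₂ (a + 1) k =
      certTerm a k * ((a + 1 / 2 + k) / (a + 1 / 2) * ((a + 1) / (a + 1 + k))) := by
    rw [term₂, certTerm, rising_add_two_eq h0, e2, show 3 / 2 - (a + 1) = 1 / 2 - a by ring]
    generalize a + 1 / 2 + k = x at *
    generalize a + 1 / 2 = y at *
    field_simp
  rw [h1, h2, certTerm_succ, shiftFactor, show (k : ℂ) + (a + 1) = a + 1 + k by ring,
    show (k : ℂ) + (1 / 2 - a) = 1 / 2 - a + k by ring,
    show 2 * a - 1 = -2 * (1 / 2 - a) by ring, show 2 * (a + 1) - 1 = 2 * (a + 1 / 2) by ring]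
  push_cast
  generalize certTerm a k = t
  -- Each linear form occurring in a denominator becomes an atom, so that denominators clear before
  -- the forms are expanded.
  obtain ⟨u, hu⟩ : ∃ u, u = 1 / 2 - a := ⟨_, rfl⟩
  obtain rfl : a = 1 / 2 - u := by rw [hu]; ring
  rw [← hu] at hbk hb0 ⊢
  obtain ⟨w, hw⟩ : ∃ w, w = u + k := ⟨_, rfl⟩
  have hkw : (k : ℂ) = w - u := by rw [hw]; ring
  rw [hkw] at hk ⊢
  rw [← hw] at hbk
  rw [show u + (w - u) = w by ring]
  obtain ⟨v, hv⟩ : ∃ v, v = 1 / 2 - u + 1 / 2 := ⟨_, rfl⟩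
  rw [← hv] at hc ⊢
  obtain ⟨x, hx⟩ : ∃ x, x = 1 / 2 - u + 1 := ⟨_, rfl⟩
  rw [← hx] at h0 hk ⊢
  obtain ⟨z, hz⟩ : ∃ z, z = x + (w - u) := ⟨_, rfl⟩
  rw [← hz] at hk ⊢
  field_simp
  obtain rfl : u = 1 - v := by rw [hv]; ring
  obtain rfl : x = v + 1 / 2 := by rw [hx]; ring
  rw [hz]
  ring

/-- The series part of the right-hand side of the second identity. -/
noncomputable def rhs₂ (a : ℂ) : ℂ := 16 * a ^ 2 / (2 * a - 1) * ∑' n : ℕ, term₂ a n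

lemma rhs₂_eq {a : ℂ} (hre : a.re < -(1 / 2)) (ha : ∀ m : ℕ, a + 1 + m ≠ 0) :
    rhs₂ a = 6 * a + 1 + shiftFactor a * rhs₂ (a + 1) := by
  have hs := (summable_norm_term₂ (a := a) (by linarith)).of_norm
  have hs' := (summable_norm_term₂ (a := a + 1) (by simp; linarith)).of_norm
  have hs1 := hs.mul_left (16 * a ^ 2 / (2 * a - 1))
  have hs2 := (hs'.mul_left (16 * (a + 1) ^ 2 / (2 * (a + 1) - 1))).mul_left (shiftFactor a)
  have h := tsum_telescope_linear_mul (summable_norm_certTerm hre) (hs1.sub hs2)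
    (term₂_telescope hre ha)
  rw [hs1.tsum_sub hs2, tsum_mul_left, tsum_mul_left, tsum_mul_left, certTerm_zero] at h
  rw [rhs₂, rhs₂]
  linear_combination h

lemma rhs₂_zero : rhs₂ 0 = 0 := by simp [rhs₂]

lemma differentiableOn_tsum_term₂ :
    DifferentiableOn ℂ (fun a => ∑' n : ℕ, term₂ a n) {a | -1 < a.re ∧ a.re < 1 / 2} := by
  have hU : IsOpen {a : ℂ | -1 < a.re ∧ a.re < 1 / 2} :=
    (isOpen_lt continuous_const Complex.continuous_re).inter
      (isOpen_lt Complex.continuous_re continuous_const)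
  refine differentiableOn_tsum_of_hypergeometric_ratio hU (T := fun n a => term₂ a n) (fun n => ?_)
    (p := fun _ => 1 / 2) (q := fun a => a + 1 / 2) (r := fun a => a + 1) (t := fun a => 3 / 2 - a)
    (by fun_prop) (by fun_prop) (by fun_prop) (by fun_prop) (fun a ha => ?_)
    (fun a _ n => term₂_succ a n)
  · rintro a ⟨h1, h2⟩
    have hr := rising_ne_zero (x := a + 1)
      (add_natCast_ne_zero_of_re_pos (by simp; linarith)) n
    have hr' := rising_ne_zero (x := 3 / 2 - a)
      (add_natCast_ne_zero_of_re_pos (by norm_num; linarith)) n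
    have d1 := differentiable_rising_comp (g := fun a => a + 1 / 2) (by fun_prop) n
    have d2 := differentiable_rising_comp (g := fun a => a + 1) (by fun_prop) n
    have d3 := differentiable_rising_comp (g := fun a => 3 / 2 - a) (by fun_prop) n
    unfold term₂
    refine DifferentiableAt.differentiableWithinAt ?_
    fun_prop (disch := exact mul_ne_zero hr hr')
  · have := ha.2
    norm_num
    linarith

lemma two_mul_sub_one_ne_zero {a : ℂ} (ha : a.re < 1 / 2) : 2 * a - 1 ≠ 0 := by
  intro h
  have := congrArg Complex.re h
  norm_num at this
  linarith

lemma differentiableOn_rhs₂ : DifferentiableOn ℂ rhs₂ {a | -1 < a.re ∧ a.re < 1 / 2} := by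
  refine DifferentiableOn.mul (fun a ha => ?_) differentiableOn_tsum_term₂
  have := two_mul_sub_one_ne_zero ha.2
  exact DifferentiableAt.differentiableWithinAt (by fun_prop (disch := assumption))

/-- Bounds the ratio of `term₂` uniformly in `Y = (Im a)²`, with `x = Re a` and `p = k + 1/2`. The
shift `9/8 = 3/2 - 3/8` is the decay exponent at the right edge of the window, whose width is one
period. -/
lemma ratio_bound_sq {x p Y : ℝ} (hx : -(5 / 8) ≤ x) (hx' : x ≤ 3 / 8) (hp : 1 / 2 ≤ p)
    (hY : 0 ≤ Y) : ((p + x) ^ 2 + Y) * (p + 9 / 8) ^ 2 ≤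
      ((p + 1 / 2 + x) ^ 2 + Y) * ((p + 1 - x) ^ 2 + Y) := by
  have h1 : ((p + x) * (p + 9 / 8)) ^ 2 ≤ ((p + 1 / 2 + x) * (p + 1 - x)) ^ 2 := by
    apply sq_le_sq'
    · nlinarith [mul_nonneg (by linarith : 0 ≤ p - 1 / 2) (by linarith : 0 ≤ x + 5 / 8),
        mul_nonneg (by linarith : 0 ≤ 3 / 8 - x) (by linarith : 0 ≤ x + 5 / 8)]
    · nlinarith [mul_nonneg (by linarith : 0 ≤ p - 1 / 2) (by linarith : 0 ≤ 3 / 8 - x),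
        mul_nonneg (by linarith : 0 ≤ 3 / 8 - x) (by linarith : 0 ≤ x + 5 / 8)]
  have h2 : (p + 9 / 8) ^ 2 ≤ (p + 1 / 2 + x) ^ 2 + (p + 1 - x) ^ 2 := by
    nlinarith [sq_nonneg (x - 1 / 4)]
  have h3 := mul_le_mul_of_nonneg_left h2 hY
  nlinarith [sq_nonneg Y]

lemma norm_sq_eq (z : ℂ) : ‖z‖ ^ 2 = z.re ^ 2 + z.im ^ 2 := by
  rw [Complex.sq_norm, Complex.normSq_apply]; ring

lemma norm_term₂_le {a : ℂ} (h1 : -(5 / 8) ≤ a.re) (h2 : a.re ≤ 3 / 8) (n : ℕ) :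
    ‖term₂ a n‖ ≤ ‖rising (1 / 2) n / rising (13 / 8) n‖ := by
  induction n with
  | zero => simp [term₂_zero, rising_zero]
  | succ k ih =>
    rw [term₂_succ, rising_succ, rising_succ, mul_div_mul_comm (rising _ _), norm_mul,
      norm_mul (rising _ _ / _)]
    refine mul_le_mul ih ?_ (norm_nonneg (_ : ℂ)) (norm_nonneg (_ : ℂ))
    have hk : (0 : ℝ) ≤ k := k.cast_nonneg
    have n1 : 0 < ‖(k : ℂ) + (a + 1)‖ :=
      norm_pos_iff.2 (by rw [add_comm]; exact add_natCast_ne_zero_of_re_pos (by simp; linarith) k)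
    have n2 : 0 < ‖(k : ℂ) + (3 / 2 - a)‖ :=
      norm_pos_iff.2 (by rw [add_comm]; exact add_natCast_ne_zero_of_re_pos (by norm_num; linarith) k)
    have n3 : ‖(13 / 8 : ℂ) + k‖ = k + 13 / 8 := by
      rw [show (13 / 8 : ℂ) + k = ((k + 13 / 8 : ℝ) : ℂ) by push_cast; ring, Complex.norm_real,
        Real.norm_of_nonneg (by positivity)]
    rw [norm_div, norm_mul, norm_mul, norm_div, n3, add_comm (1 / 2 : ℂ),
      div_le_div_iff₀ (by positivity) (by positivity), mul_assoc]
    refine mul_le_mul_of_nonneg_left ?_ (norm_nonneg _)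
    refine le_of_sq_le_sq ?_ (by positivity)
    rw [mul_pow, mul_pow, norm_sq_eq, norm_sq_eq, norm_sq_eq]
    have := ratio_bound_sq h1 h2 (p := k + 1 / 2) (by linarith) (sq_nonneg a.im)
    norm_num
    norm_num at this
    ring_nf at this ⊢
    exact this

lemma exists_norm_tsum_term₂_le : ∃ C : ℝ, 0 ≤ C ∧ ∀ a : ℂ, -(5 / 8) ≤ a.re → a.re ≤ 3 / 8 →
    ‖∑' n, term₂ a n‖ ≤ C := by
  have hs : Summable fun n => ‖rising (1 / 2) n / rising (13 / 8) n‖ := by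
    -- The cancelling parameters `q = t = 1` only bring the ratio to two-over-two form; the excess
    -- `13/8 - 1/2 = 9/8` exceeds `1`.
    refine summable_norm_of_hypergeometric_ratio (p := 1 / 2) (q := 1) (r := 13 / 8) (t := 1)
      (by norm_num) fun n => ?_
    have : (n : ℂ) + 1 ≠ 0 := by exact_mod_cast n.succ_ne_zero
    rw [mul_div_mul_right _ _ this, rising_succ, rising_succ, mul_div_mul_comm, add_comm (n : ℂ),
      add_comm (n : ℂ)]
  exact ⟨_, tsum_nonneg fun n => norm_nonneg _, fun a h1 h2 =>
    tsum_of_norm_bounded hs.hasSum (norm_term₂_le h1 h2)⟩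

/-- The difference of `f` and the series part of the second identity. -/
noncomputable def resid (a : ℂ) : ℂ := f a - rhs₂ a

lemma resid_eq {a : ℂ} (hre : a.re < -(1 / 2)) (ha : ∀ m : ℕ, a + 1 + m ≠ 0) :
    resid a = shiftFactor a * resid (a + 1) := by
  rw [resid, resid, f_eq, rhs₂_eq hre ha]
  ring

lemma rising_zero_succ (n : ℕ) : rising 0 (n + 1) = 0 := by rw [rising_succ', zero_mul]

/-- At `-1/2` the factor `(a + 1/2)_n` vanishes for `n ≥ 1`, so both series reduce to their first
term. This zero lowers by one the order of the triple pole of the weight. -/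
lemma resid_neg_half : resid (-1 / 2) = 0 := by
  have h1 : f (-1 / 2) = -2 := by
    rw [f, tsum_eq_single 0, fTerm_zero]
    · norm_num
    · intro n hn
      obtain ⟨m, rfl⟩ := Nat.exists_eq_succ_of_ne_zero hn
      rw [fTerm, show (-1 / 2 : ℂ) + 1 / 2 = 0 by norm_num, Nat.succ_eq_add_one, rising_zero_succ]
      simp
  have h2 : rhs₂ (-1 / 2) = -2 := by
    rw [rhs₂, tsum_eq_single 0, term₂_zero]
    · norm_num
    · intro n hn
      obtain ⟨m, rfl⟩ := Nat.exists_eq_succ_of_ne_zero hn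
      rw [term₂, show (-1 / 2 : ℂ) + 1 / 2 = 0 by norm_num, Nat.succ_eq_add_one, rising_zero_succ]
      simp
  rw [resid, h1, h2, sub_self]

lemma resid_zero : resid 0 = 4 / (Real.pi : ℂ) := by rw [resid, f_zero, rhs₂_zero, sub_zero]

lemma differentiableOn_resid : DifferentiableOn ℂ resid {a | -(3 / 4) < a.re ∧ a.re < 1 / 2} :=
  (differentiableOn_f.mono fun _ ha => ha.1).sub
    (differentiableOn_rhs₂.mono fun a ha => ⟨by have := ha.1; linarith, ha.2⟩)

/-- On the imaginary axis `|2 a - 1| ≥ 2 |a|` saves a power of `|a|`. The saving is essential for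
the `o(e^{2π|y|})` bound there; elsewhere the quadratic bound suffices. -/
lemma exists_norm_resid_le : ∃ C : ℝ, 0 ≤ C ∧
    (∀ a : ℂ, -(5 / 8) ≤ a.re → a.re ≤ 3 / 8 → ‖resid a‖ ≤ C * (1 + ‖a‖) ^ 2) ∧
    (∀ a : ℂ, a.re = 0 → ‖resid a‖ ≤ C * (1 + ‖a‖)) := by
  obtain ⟨C₁, hC₁, h₁⟩ := exists_norm_f_le
  obtain ⟨C₂, hC₂, h₂⟩ := exists_norm_tsum_term₂_le
  refine ⟨C₁ + 64 * C₂, by positivity, fun a ha ha' => ?_, fun a ha => ?_⟩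
  · have n0 := norm_nonneg a
    have hd : 1 / 4 ≤ ‖2 * a - 1‖ := by
      have := Complex.abs_re_le_norm (2 * a - 1)
      have h := neg_le_abs (2 * a - 1).re
      norm_num at h this
      linarith
    have hr : ‖rhs₂ a‖ ≤ 64 * C₂ * (1 + ‖a‖) ^ 2 := by
      rw [rhs₂, norm_mul, norm_div, norm_mul, norm_pow]
      simp only [RCLike.norm_ofNat]
      calc 16 * ‖a‖ ^ 2 / ‖2 * a - 1‖ * ‖∑' n, term₂ a n‖ ≤ 16 * ‖a‖ ^ 2 / (1 / 4) * C₂ := by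
            gcongr; exact h₂ a ha ha'
        _ = 64 * C₂ * ‖a‖ ^ 2 := by ring
        _ ≤ _ := by gcongr; linarith
    calc ‖resid a‖ ≤ ‖f a‖ + ‖rhs₂ a‖ := norm_sub_le _ _
      _ ≤ C₁ * (1 + ‖a‖) + 64 * C₂ * (1 + ‖a‖) ^ 2 := add_le_add (h₁ a (by linarith)) hr
      _ ≤ C₁ * (1 + ‖a‖) ^ 2 + 64 * C₂ * (1 + ‖a‖) ^ 2 := by
        gcongr
        exact le_self_pow₀ (by linarith) two_ne_zero
      _ = _ := by ring
  · have n0 := norm_nonneg a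
    have hd : 2 * ‖a‖ ≤ ‖2 * a - 1‖ := by
      have := norm_add_le_norm_add (z := -2 * a) (x := 0) (y := 1) (by norm_num) (by simp [ha])
      rw [← norm_neg (2 * a - 1)]
      calc 2 * ‖a‖ = ‖-2 * a + (0 : ℝ)‖ := by simp
        _ ≤ _ := this
        _ = _ := by congr 1; push_cast; ring
    have hr : ‖rhs₂ a‖ ≤ 64 * C₂ * (1 + ‖a‖) := by
      rw [rhs₂, norm_mul, norm_div, norm_mul, norm_pow]
      simp only [RCLike.norm_ofNat]
      rcases n0.eq_or_lt with h0 | h0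
      · rw [← h0]; simp; positivity
      calc 16 * ‖a‖ ^ 2 / ‖2 * a - 1‖ * ‖∑' n, term₂ a n‖ ≤ 16 * ‖a‖ ^ 2 / (2 * ‖a‖) * C₂ := by
            gcongr; exact h₂ a (by linarith) (by linarith)
        _ = 8 * C₂ * ‖a‖ := by field_simp; ring
        _ ≤ _ := by nlinarith
    calc ‖resid a‖ ≤ ‖f a‖ + ‖rhs₂ a‖ := norm_sub_le _ _
      _ ≤ C₁ * (1 + ‖a‖) + 64 * C₂ * (1 + ‖a‖) := add_le_add (h₁ a (by linarith)) hr
      _ = _ := by ring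

end RamanujanExt

/-! ### A Liouville theorem for entire functions of period one. -/

namespace RamanujanExt

open Filter Topology Finset UpperHalfPlane Function

lemma norm_qParam_one (z : ℂ) : ‖Periodic.qParam 1 z‖ = Real.exp (-2 * Real.pi * z.im) := by
  rw [Periodic.norm_qParam, div_one]

lemma periodic_qParam_one : Periodic (Periodic.qParam 1) ((1 : ℝ) : ℂ) := by
  intro z
  simp only [Periodic.qParam, Complex.ofReal_one, div_one, mul_add, mul_one]
  exact Complex.exp_periodic _

/-- In `q = e^{2πiz}` the general bound permits at most a simple pole at `q = 0`, and the decay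
along the imaginary axis excludes it. -/
lemma boundedAtFilter_of_growth {F : ℂ → ℂ} (hd : Differentiable ℂ F) (hp : Periodic F ((1 : ℝ) : ℂ))
    {C : ℝ} (hb : ∀ z : ℂ, 1 ≤ z.im → ‖F z‖ ≤ C * (2 + z.im) ^ 2 * Real.exp (2 * Real.pi * z.im))
    (h0 : Tendsto (fun y : ℝ => ‖F (y * Complex.I)‖ * Real.exp (-2 * Real.pi * y)) atTop (𝓝 0)) :
    BoundedAtFilter (comap Complex.im atTop) F := by
  have hpi := Real.pi_pos
  have hq := Periodic.differentiable_qParam (h := 1)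
  -- If `G q → 0` then `G q = O(|q|)` by removability, so `G` is bounded. It is used with `G = F q`,
  -- then with `G = F`.
  have key : ∀ G : ℂ → ℂ, Differentiable ℂ G → Periodic G ((1 : ℝ) : ℂ) →
      ZeroAtFilter (comap Complex.im atTop) (fun z => G z * Periodic.qParam 1 z) →
      BoundedAtFilter (comap Complex.im atTop) G := by
    intro G hG hGp hz
    have h := Periodic.exp_decay_of_zero_at_inf one_pos (hGp.mul periodic_qParam_one)
      (Eventually.of_forall fun z => (hG.mul hq) z) hz
    obtain ⟨c, hc⟩ := h.bound
    refine Asymptotics.IsBigO.of_bound c ?_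
    filter_upwards [hc] with z hz
    rw [Pi.mul_apply, norm_mul, norm_qParam_one, div_one, Real.norm_of_nonneg (Real.exp_pos _).le] at hz
    simpa using le_of_mul_le_mul_right hz (Real.exp_pos _)
  have hFq : BoundedAtFilter (comap Complex.im atTop) (fun z => F z * Periodic.qParam 1 z) := by
    refine key _ (hd.mul hq) (hp.mul periodic_qParam_one) ?_
    have hlim : Tendsto (fun y : ℝ => C * ((2 + y) ^ 2 * Real.exp (-(2 * Real.pi) * (2 + y))) *
        Real.exp (4 * Real.pi)) atTop (𝓝 (C * 0 * Real.exp (4 * Real.pi))) := by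
      refine ((Tendsto.comp (g := fun x : ℝ => x ^ 2 * Real.exp (-(2 * Real.pi) * x)) ?_
        (tendsto_atTop_add_const_left atTop 2 tendsto_id)).const_mul C).mul_const _
      have := tendsto_rpow_mul_exp_neg_mul_atTop_nhds_zero 2 (2 * Real.pi) (by positivity)
      simpa using this
    rw [mul_zero, zero_mul] at hlim
    refine squeeze_zero_norm' ?_ (hlim.comp tendsto_comap)
    filter_upwards [tendsto_comap.eventually (eventually_ge_atTop (1 : ℝ))] with z hz
    rw [norm_mul, norm_mul, norm_qParam_one]
    calc ‖F z‖ * Real.exp (-2 * Real.pi * z.im) * Real.exp (-2 * Real.pi * z.im)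
        ≤ C * (2 + z.im) ^ 2 * Real.exp (2 * Real.pi * z.im) * Real.exp (-2 * Real.pi * z.im) *
          Real.exp (-2 * Real.pi * z.im) := by gcongr; exact hb z hz
      _ = C * (2 + z.im) ^ 2 * Real.exp (2 * Real.pi * z.im + -2 * Real.pi * z.im +
          -2 * Real.pi * z.im) := by rw [Real.exp_add, Real.exp_add]; ring
      _ = C * (2 + z.im) ^ 2 * Real.exp (-(2 * Real.pi) * (2 + z.im) + 4 * Real.pi) := by
        congr 2; ring
      _ = _ := by rw [Real.exp_add, comp_apply]; ring
  refine key F hd hp ?_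
  -- Since `F q` is bounded it has a limit at `i∞`, which the imaginary axis alone identifies as
  -- `0`.
  have hT := Periodic.tendsto_at_I_inf one_pos (hp.mul periodic_qParam_one)
    (Eventually.of_forall fun z => (hd.mul hq) z) hFq
  have hI : Tendsto (fun y : ℝ => (y : ℂ) * Complex.I) atTop (comap Complex.im atTop) := by
    rw [tendsto_comap_iff]
    refine tendsto_id.congr fun y => by simp
  have h1 := hT.comp hI
  have h2 : Tendsto ((F * Periodic.qParam 1) ∘ fun y : ℝ => (y : ℂ) * Complex.I) atTop (𝓝 0) := by
    rw [tendsto_zero_iff_norm_tendsto_zero]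
    refine h0.congr fun y => ?_
    simp [norm_qParam_one]
  rw [tendsto_nhds_unique h1 h2] at hT
  exact hT

/-- An entire function of period one which grows slower than `exp (2 π |Im z|)` along the
imaginary axis, and not much faster elsewhere, is constant. -/
lemma eq_of_periodic_of_growth {F : ℂ → ℂ} (hd : Differentiable ℂ F)
    (hp : Periodic F ((1 : ℝ) : ℂ)) {C : ℝ}
    (hb : ∀ z : ℂ, 1 ≤ |z.im| → ‖F z‖ ≤ C * (2 + |z.im|) ^ 2 * Real.exp (2 * Real.pi * |z.im|))
    (h0 : Tendsto (fun y : ℝ => ‖F (y * Complex.I)‖ * Real.exp (-2 * Real.pi * y)) atTop (𝓝 0))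
    (h0' : Tendsto (fun y : ℝ => ‖F (-(y * Complex.I))‖ * Real.exp (-2 * Real.pi * y)) atTop (𝓝 0))
    (z w : ℂ) : F z = F w := by
  have hup := boundedAtFilter_of_growth hd hp (C := C) (fun z hz => by
    have := hb z (hz.trans (le_abs_self _))
    rwa [abs_of_nonneg (by linarith)] at this) h0
  have hp' : Periodic (fun z => F (-z)) ((1 : ℝ) : ℂ) := fun z => by
    have := hp (-(z + ((1 : ℝ) : ℂ)))
    simp only [neg_add_rev, neg_add_cancel_comm] at this ⊢
    exact this.symm
  have hdown := boundedAtFilter_of_growth (F := fun z => F (-z)) (by fun_prop) hp' (C := C)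
    (fun z hz => by
      have := hb (-z) (by rw [Complex.neg_im, abs_neg]; exact hz.trans (le_abs_self _))
      rwa [Complex.neg_im, abs_neg, abs_of_nonneg (by linarith)] at this) h0'
  obtain ⟨c₁, hc₁⟩ := hup.bound
  obtain ⟨c₂, hc₂⟩ := hdown.bound
  rw [eventually_comap, eventually_atTop] at hc₁ hc₂
  obtain ⟨Y₁, hY₁⟩ := hc₁
  obtain ⟨Y₂, hY₂⟩ := hc₂
  have hcomp : IsCompact (Set.Icc (0 : ℝ) 1 ×ℂ Set.Icc (-Y₂) Y₁) :=
    isCompact_Icc.reProdIm isCompact_Icc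
  obtain ⟨c₃, hc₃⟩ := hcomp.exists_bound_of_continuousOn hd.continuous.continuousOn
  refine hd.apply_eq_apply_of_bounded ?_ z w
  rw [isBounded_iff_forall_norm_le]
  refine ⟨max c₁ (max c₂ c₃), ?_⟩
  rintro _ ⟨z, rfl⟩
  by_cases h1 : Y₁ ≤ z.im
  · have := hY₁ _ h1 z rfl
    simp at this
    exact this.trans (le_max_left _ _)
  by_cases h2 : z.im ≤ -Y₂
  · have := hY₂ (-z).im (by simp; linarith) (-z) rfl
    simp at this
    exact this.trans ((le_max_left _ _).trans (le_max_right _ _))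
  · have h3 : F z = F (z - ⌊z.re⌋) := by
      have := hp.sub_int_mul_eq (x := z) ⌊z.re⌋
      simpa using this.symm
    rw [h3]
    refine (hc₃ _ ?_).trans ((le_max_right _ _).trans (le_max_right _ _))
    rw [Complex.mem_reProdIm]
    simp only [Complex.sub_re, Complex.intCast_re, Complex.sub_im, Complex.intCast_im, sub_zero]
    push Not at h1 h2
    exact ⟨⟨sub_nonneg.2 (Int.floor_le _), by linarith [Int.lt_floor_add_one z.re]⟩, h2.le, h1.le⟩

end RamanujanExt

/-! ### Gamma quotients, the periodic product, and the second identity. -/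

namespace RamanujanExt

open Filter Topology Finset Function

/-- The quotient `Γ(a + 1/2) / Γ(a + 1)`. -/
noncomputable def gammaRatio (a : ℂ) : ℂ := Complex.Gamma (a + 1 / 2) / Complex.Gamma (a + 1)

lemma gammaRatio_add_one {a : ℂ} (h : a + 1 / 2 ≠ 0) (h' : a + 1 ≠ 0) :
    gammaRatio (a + 1) = (a + 1 / 2) / (a + 1) * gammaRatio a := by
  rw [gammaRatio, gammaRatio, show a + 1 + 1 / 2 = a + 1 / 2 + 1 by ring, Complex.Gamma_add_one _ h,
    Complex.Gamma_add_one _ h', div_mul_div_comm]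

/-- The quotient is `B(a + 1/2, 1/2)/Γ(1/2)`, and on `(0,1)` the Beta integrand is dominated by its
absolute value at `Re a = 1/4`, hence the exponent `3/4 = 1/4 + 1/2`. -/
lemma exists_norm_gammaRatio_le :
    ∃ C : ℝ, 0 ≤ C ∧ ∀ a : ℂ, 1 / 4 ≤ a.re → ‖gammaRatio a‖ ≤ C := by
  have hint := (Complex.betaIntegral_convergent (u := 3 / 4) (v := 1 / 2) (by norm_num)
    (by norm_num)).norm
  set B := ∫ x in (0 : ℝ)..1, ‖(x : ℂ) ^ ((3 / 4 : ℂ) - 1) * (1 - (x : ℂ)) ^ ((1 / 2 : ℂ) - 1)‖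
  have hg : Complex.Gamma (1 / 2) ≠ 0 := Complex.Gamma_ne_zero_of_re_pos (by norm_num)
  have hB : 0 ≤ B := intervalIntegral.integral_nonneg zero_le_one fun x _ => norm_nonneg _
  refine ⟨B / ‖Complex.Gamma (1 / 2)‖, by positivity, fun a ha => ?_⟩
  have h1 := Complex.Gamma_mul_Gamma_eq_betaIntegral (s := a + 1 / 2) (t := 1 / 2)
    (by norm_num; linarith) (by norm_num)
  rw [show a + 1 / 2 + 1 / 2 = a + 1 by ring] at h1
  have hg1 : Complex.Gamma (a + 1) ≠ 0 :=
    Complex.Gamma_ne_zero_of_re_pos (by simp; linarith)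
  have h2 : gammaRatio a = Complex.betaIntegral (a + 1 / 2) (1 / 2) / Complex.Gamma (1 / 2) := by
    rw [gammaRatio, div_eq_div_iff hg1 hg, h1, mul_comm]
  rw [h2, norm_div]
  refine div_le_div_of_nonneg_right ?_ (norm_nonneg _)
  refine intervalIntegral.norm_integral_le_of_norm_le zero_le_one ?_ hint
  refine (MeasureTheory.ae_of_all _ fun x hx => ?_)
  rw [norm_mul, norm_mul, Complex.norm_cpow_eq_rpow_re_of_pos hx.1,
    Complex.norm_cpow_eq_rpow_re_of_pos hx.1]
  refine mul_le_mul_of_nonneg_right ?_ (norm_nonneg _)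
  refine Real.rpow_le_rpow_of_exponent_ge hx.1 hx.2 ?_
  norm_num
  linarith

lemma gammaRatio_mul_gammaRatio_neg {a : ℂ} (ha : a ≠ 0) :
    gammaRatio a * gammaRatio (-a) = Complex.tan (Real.pi * a) / a := by
  have hpi : (Real.pi : ℂ) ≠ 0 := Complex.ofReal_ne_zero.2 Real.pi_ne_zero
  have h1 := Complex.Gamma_mul_Gamma_one_sub (a + 1 / 2)
  have h2 := Complex.Gamma_mul_Gamma_one_sub a
  rw [show 1 - (a + 1 / 2) = -a + 1 / 2 by ring,
    show (Real.pi : ℂ) * (a + 1 / 2) = Real.pi * a + Real.pi / 2 by ring,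
    Complex.sin_add_pi_div_two] at h1
  rw [gammaRatio, gammaRatio, div_mul_div_comm, h1, Complex.Gamma_add_one _ ha, mul_assoc,
    show -a + 1 = 1 - a by ring, h2, Complex.tan]
  simp only [div_eq_mul_inv, mul_inv, inv_inv]
  field_simp

lemma gammaRatio_conj (a : ℂ) :
    gammaRatio (starRingEnd ℂ a) = starRingEnd ℂ (gammaRatio a) := by
  rw [gammaRatio, gammaRatio, map_div₀, ← Complex.Gamma_conj, ← Complex.Gamma_conj, map_add, map_add,
    map_one, map_div₀, map_one, Complex.conj_ofNat]

/-- By conjugation symmetry the reflection formula at `iy` gives the exact value `tanh(πy)/y`. -/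
lemma norm_gammaRatio_sq_le {y : ℝ} (hy : 0 < y) : ‖gammaRatio (y * Complex.I)‖ ^ 2 ≤ 1 / y := by
  have hy0 : (y : ℂ) ≠ 0 := Complex.ofReal_ne_zero.2 hy.ne'
  have h1 := gammaRatio_mul_gammaRatio_neg (a := y * Complex.I) (mul_ne_zero hy0 Complex.I_ne_zero)
  have h2 : -(y * Complex.I) = starRingEnd ℂ (y * Complex.I) := by simp
  rw [h2, gammaRatio_conj, Complex.mul_conj, ← mul_assoc, Complex.tan_mul_I,
    mul_div_mul_right _ _ Complex.I_ne_zero, ← Complex.ofReal_mul, ← Complex.ofReal_tanh,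
    ← Complex.ofReal_div, Complex.ofReal_inj, Complex.normSq_eq_norm_sq] at h1
  rw [h1]
  gcongr
  exact (Real.tanh_lt_one _).le

/-- The weight which makes the homogeneous functional equation periodic. -/
noncomputable def weight (a : ℂ) : ℂ := 4 ^ (-a) * gammaRatio a ^ 3

lemma weight_add_one {a : ℂ} (h : a + 1 / 2 ≠ 0) (h' : a + 1 ≠ 0) :
    weight (a + 1) = shiftFactor a * weight a := by
  rw [weight, weight, gammaRatio_add_one h h', neg_add, Complex.cpow_add _ _ (by norm_num),
    shiftFactor, Complex.cpow_neg 4 1, Complex.cpow_one, mul_pow, div_pow]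
  field_simp

lemma cos_sq_add_one (a : ℂ) :
    Complex.cos (Real.pi * (a + 1)) ^ 2 = Complex.cos (Real.pi * a) ^ 2 := by
  rw [mul_add, mul_one, Complex.cos_add_pi, neg_sq]

/-- The product `cos² π a · weight a · resid a`, in a form which is regular at `-1/2`. -/
noncomputable def regProduct (a : ℂ) : ℂ :=
  (Real.pi * (Complex.Gamma (1 / 2 - a))⁻¹) ^ 2 * 4 ^ (-a) * Complex.Gamma (a + 3 / 2) *
    (Complex.Gamma (a + 1))⁻¹ ^ 3 * dslope resid (-1 / 2) a

/-- The strip on which `resid` is used. -/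
def strip : Set ℂ := {a | -(3 / 4) < a.re ∧ a.re < 1 / 2}

lemma isOpen_strip : IsOpen strip :=
  (isOpen_lt continuous_const Complex.continuous_re).inter
    (isOpen_lt Complex.continuous_re continuous_const)

lemma differentiableOn_regProduct : DifferentiableOn ℂ regProduct strip := by
  have h1 : DifferentiableOn ℂ (dslope resid (-1 / 2)) strip :=
    (Complex.differentiableOn_dslope (isOpen_strip.mem_nhds (by norm_num [strip]))).2
      differentiableOn_resid
  have h2 : Differentiable ℂ fun a : ℂ => (Complex.Gamma (1 / 2 - a))⁻¹ :=
    Complex.differentiable_one_div_Gamma.comp (by fun_prop : Differentiable ℂ fun a : ℂ => 1 / 2 - a)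
  have h3 : Differentiable ℂ fun a : ℂ => (Complex.Gamma (a + 1))⁻¹ :=
    Complex.differentiable_one_div_Gamma.comp (by fun_prop : Differentiable ℂ fun a : ℂ => a + 1)
  have h4 : DifferentiableOn ℂ (fun a => Complex.Gamma (a + 3 / 2)) strip := fun a ha => by
    have : DifferentiableAt ℂ Complex.Gamma (a + 3 / 2) :=
      Complex.differentiableAt_Gamma _ fun m hm => by
        have := congrArg Complex.re hm
        have h5 := ha.1
        have h6 := m.cast_nonneg (α := ℝ)
        norm_num at this
        linarith
    exact (this.comp a (by fun_prop : DifferentiableAt ℂ (fun a => a + 3 / 2) a)).differentiableWithinAt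
  have h5 : Differentiable ℂ fun a : ℂ => (4 : ℂ) ^ (-a) := fun a =>
    DifferentiableAt.const_cpow (by fun_prop) (Or.inl (by norm_num))
  exact (((((h2.const_mul _).pow 2).mul h5).differentiableOn.mul h4).mul
    (h3.pow 3).differentiableOn).mul h1

lemma cos_ne_zero_of_mem_strip {a : ℂ} (ha : a ∈ strip) (h : a ≠ -1 / 2) :
    Complex.cos (Real.pi * a) ≠ 0 := by
  have hpi : (Real.pi : ℂ) ≠ 0 := Complex.ofReal_ne_zero.2 Real.pi_ne_zero
  intro hc
  obtain ⟨k, hk⟩ := Complex.cos_eq_zero_iff.1 hc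
  have hak : a = ((2 * k + 1 : ℤ) : ℂ) / 2 := by
    push_cast
    field_simp at hk ⊢
    exact hk
  have hre : a.re = ((2 * k + 1 : ℤ) : ℝ) / 2 := by
    rw [hak]
    rw [show (((2 * k + 1 : ℤ) : ℂ) / 2) = ((((2 * k + 1 : ℤ) : ℝ) / 2 : ℝ) : ℂ) by push_cast; rfl,
      Complex.ofReal_re]
  obtain ⟨h1, h2⟩ := ha
  rw [hre] at h1 h2
  have h3 : (-2 : ℝ) < (2 * k + 1 : ℤ) := by linarith
  have h4 : ((2 * k + 1 : ℤ) : ℝ) < 1 := by linarith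
  have h5 : -2 < 2 * k + 1 := by exact_mod_cast h3
  have h6 : 2 * k + 1 < 1 := by exact_mod_cast h4
  have h7 : k = -1 := by omega
  apply h
  rw [hak, h7]
  norm_num

lemma Gamma_half_reflection {a : ℂ} (hc : Complex.cos (Real.pi * a) ≠ 0) :
    Real.pi * (Complex.Gamma (1 / 2 - a))⁻¹ =
      Complex.cos (Real.pi * a) * Complex.Gamma (a + 1 / 2) := by
  have hpi : (Real.pi : ℂ) ≠ 0 := Complex.ofReal_ne_zero.2 Real.pi_ne_zero
  have h1 := Complex.Gamma_mul_Gamma_one_sub (a + 1 / 2)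
  rw [show 1 - (a + 1 / 2) = 1 / 2 - a by ring,
    show (Real.pi : ℂ) * (a + 1 / 2) = Real.pi * a + Real.pi / 2 by ring,
    Complex.sin_add_pi_div_two] at h1
  have h2 : Complex.Gamma (a + 1 / 2) * Complex.Gamma (1 / 2 - a) ≠ 0 := by
    rw [h1]; exact div_ne_zero hpi hc
  have h3 := right_ne_zero_of_mul h2
  rw [eq_div_iff hc] at h1
  rw [← div_eq_mul_inv, div_eq_iff h3]
  linear_combination -h1

/-- Reflection turns `cos(πa) Γ(a + 1/2)` into the entire `π/Γ(1/2 - a)`, twice; the third `Γ(a +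
1/2)` times `resid a` is `Γ(a + 3/2)` times the slope of `resid` at its zero. -/
lemma regProduct_eq {a : ℂ} (ha : a ∈ strip) (h : a ≠ -1 / 2) :
    regProduct a = Complex.cos (Real.pi * a) ^ 2 * weight a * resid a := by
  have h2 : a + 1 / 2 ≠ 0 := fun h' => h (by linear_combination h')
  rw [regProduct, Gamma_half_reflection (cos_ne_zero_of_mem_strip ha h), dslope_of_ne _ h,
    slope_def_field, resid_neg_half, sub_zero, show a + 3 / 2 = a + 1 / 2 + 1 by ring,
    Complex.Gamma_add_one _ h2, weight, gammaRatio, show a - -1 / 2 = a + 1 / 2 by ring]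
  generalize a + 1 / 2 = x at *
  field_simp

lemma regProduct_add_one {a : ℂ} (h1 : -(3 / 4) < a.re) (h2 : a.re < -(1 / 2)) :
    regProduct (a + 1) = regProduct a := by
  have hne : a ≠ -1 / 2 := by rintro rfl; norm_num at h2
  have hne' : a + 1 ≠ -1 / 2 := fun h => by
    have := congrArg Complex.re h; norm_num at this; linarith
  rw [regProduct_eq ⟨h1, by linarith⟩ hne,
    regProduct_eq ⟨by simp; linarith, by simp; linarith⟩ hne', cos_sq_add_one,
    resid_eq h2 (add_natCast_ne_zero_of_re_pos (by simp; linarith)), weight_add_one]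
  · ring
  · intro h; exact hne (by linear_combination h)
  · intro h
    have := congrArg Complex.re h; norm_num at this; linarith

/-- The periodic extension of `regProduct`. -/
noncomputable def perProduct (z : ℂ) : ℂ := regProduct (z - ⌊z.re + 5 / 8⌋)

lemma periodic_perProduct : Periodic perProduct ((1 : ℝ) : ℂ) := by
  intro z
  rw [perProduct, perProduct]
  congr 1
  rw [Complex.add_re, Complex.ofReal_re, add_right_comm, Int.floor_add_one]
  push_cast
  ring

lemma sub_floor_re (z : ℂ) : -(5 / 8) ≤ (z - ⌊z.re + 5 / 8⌋).re ∧ (z - ⌊z.re + 5 / 8⌋).re < 3 / 8 := by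
  have h1 := Int.floor_le (z.re + 5 / 8)
  have h2 := Int.lt_floor_add_one (z.re + 5 / 8)
  simp only [Complex.sub_re, Complex.intCast_re]
  constructor <;> linarith

lemma perProduct_eq {z : ℂ} {n : ℤ} (h : z - n ∈ strip) : perProduct z = regProduct (z - n) := by
  obtain ⟨h1, h2⟩ := sub_floor_re z
  obtain ⟨h3, h4⟩ := h
  rw [perProduct]
  set m := ⌊z.re + 5 / 8⌋
  simp only [Complex.sub_re, Complex.intCast_re] at h1 h2 h3 h4
  -- Both translates lie in a strip of width `5/4`, so the integers differ by at most one, and one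
  -- application of the shift relation compares them.
  have h5 : (m : ℝ) < n + 2 := by linarith
  have h6 : (n : ℝ) < m + 2 := by linarith
  have h5' : m < n + 2 := by exact_mod_cast h5
  have h6' : n < m + 2 := by exact_mod_cast h6
  rcases (by omega : m = n ∨ m = n + 1 ∨ n = m + 1) with h | h | h
  · rw [h]
  · rw [h] at h1 h2 ⊢
    push_cast at h1 h2
    rw [← regProduct_add_one]
    · congr 1; push_cast; ring
    · simp; linarith
    · simp; linarith
  · rw [h] at h3 h4 ⊢
    push_cast at h3 h4
    rw [← regProduct_add_one (a := z - (m + 1 : ℤ))]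
    · congr 1; push_cast; ring
    · simp; linarith
    · simp; linarith

lemma differentiable_perProduct : Differentiable ℂ perProduct := by
  intro z
  set m := ⌊z.re + 5 / 8⌋
  have hz : z - m ∈ strip := by
    obtain ⟨h1, h2⟩ := sub_floor_re z
    exact ⟨by linarith, by linarith⟩
  have hcont : ContinuousAt (fun w : ℂ => w - m) z := by fun_prop
  have hev : ∀ᶠ w : ℂ in 𝓝 z, w - m ∈ strip := hcont.eventually_mem (isOpen_strip.mem_nhds hz)
  have hd := (differentiableOn_regProduct.differentiableAt (isOpen_strip.mem_nhds hz)).comp z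
    (by fun_prop : DifferentiableAt ℂ (fun w : ℂ => w - m) z)
  refine hd.congr_of_eventuallyEq ?_
  filter_upwards [hev] with w hw using perProduct_eq hw

lemma norm_cos_le (z : ℂ) : ‖Complex.cos z‖ ≤ Real.exp |z.im| := by
  rw [Complex.cos, norm_div, RCLike.norm_ofNat, div_le_iff₀ two_pos]
  refine (norm_add_le _ _).trans ?_
  rw [Complex.norm_exp, Complex.norm_exp]
  have h1 : Real.exp (z * Complex.I).re ≤ Real.exp |z.im| := by
    simpa using neg_le_abs z.im
  have h2 : Real.exp (-z * Complex.I).re ≤ Real.exp |z.im| := by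
    simpa using le_abs_self z.im
  linarith

lemma norm_cos_pi_sq_le (z : ℂ) :
    ‖Complex.cos (Real.pi * z) ^ 2‖ ≤ Real.exp (2 * Real.pi * |z.im|) := by
  rw [norm_pow]
  calc ‖Complex.cos (Real.pi * z)‖ ^ 2 ≤ Real.exp |(Real.pi * z).im| ^ 2 := by
        gcongr; exact norm_cos_le _
    _ = _ := by
      rw [← Real.exp_nat_mul, Complex.im_ofReal_mul, abs_mul, abs_of_pos Real.pi_pos]
      push_cast
      ring_nf

lemma norm_four_cpow_le {a : ℂ} (ha : -1 ≤ a.re) : ‖(4 : ℂ) ^ (-a)‖ ≤ 4 := by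
  rw [show (4 : ℂ) = ((4 : ℝ) : ℂ) by norm_num, Complex.norm_cpow_eq_rpow_re_of_pos (by norm_num)]
  calc (4 : ℝ) ^ (-a).re ≤ 4 ^ (1 : ℝ) := by
        apply Real.rpow_le_rpow_of_exponent_le (by norm_num)
        simp; linarith
    _ = 4 := Real.rpow_one 4

/-- One step of the recurrence reaches `Re a ≥ 1/4`; away from the real axis its factor `(a + 1)/(a
+ 1/2)` has norm at most `2`. -/
lemma exists_norm_gammaRatio_le_of_one_le_im : ∃ C : ℝ, 0 ≤ C ∧
    ∀ a : ℂ, -(5 / 8) ≤ a.re → 1 ≤ |a.im| → ‖gammaRatio a‖ ≤ C := by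
  obtain ⟨C, hC, h⟩ := exists_norm_gammaRatio_le
  refine ⟨2 * C, by positivity, fun a ha him => ?_⟩
  have hn : 1 ≤ ‖a + 1 / 2‖ := by
    refine him.trans ?_
    have := Complex.abs_im_le_norm (a + 1 / 2)
    norm_num at this ⊢
    exact this
  have h1 : a + 1 / 2 ≠ 0 := norm_pos_iff.1 (by linarith)
  have h2 : a + 1 ≠ 0 := fun h => by
    have := congrArg Complex.re h; norm_num at this; linarith
  have h3 := gammaRatio_add_one h1 h2
  have h4 : gammaRatio a = (1 + 1 / 2 / (a + 1 / 2)) * gammaRatio (a + 1) := by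
    rw [h3, show 1 + 1 / 2 / (a + 1 / 2) = (a + 1) / (a + 1 / 2) by
      rw [eq_div_iff h1, add_mul, div_mul_cancel₀ _ h1]; ring, ← mul_assoc,
      div_mul_div_cancel₀ h1, div_self h2, one_mul]
  rw [h4, norm_mul]
  have h5 : ‖1 + 1 / 2 / (a + 1 / 2)‖ ≤ 2 := by
    refine (norm_add_le _ _).trans ?_
    rw [norm_div]
    have : ‖(1 / 2 : ℂ)‖ / ‖a + 1 / 2‖ ≤ 1 := by
      rw [div_le_one (by linarith)]
      norm_num
      norm_num at hn
      linarith
    simp only [norm_one]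
    linarith
  exact mul_le_mul h5 (h _ (by simp; linarith)) (norm_nonneg _) (by norm_num)

lemma exists_norm_perProduct_le : ∃ C : ℝ, ∀ z : ℂ, 1 ≤ |z.im| →
    ‖perProduct z‖ ≤ C * (2 + |z.im|) ^ 2 * Real.exp (2 * Real.pi * |z.im|) := by
  obtain ⟨C₁, hC₁, h₁⟩ := exists_norm_gammaRatio_le_of_one_le_im
  obtain ⟨C₂, hC₂, h₂, -⟩ := exists_norm_resid_le
  refine ⟨4 * C₁ ^ 3 * C₂, fun z hz => ?_⟩
  obtain ⟨h3, h4⟩ := sub_floor_re z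
  rw [perProduct]
  have him : z.im = (z - ⌊z.re + 5 / 8⌋).im := by simp
  rw [him] at hz ⊢
  generalize z - ⌊z.re + 5 / 8⌋ = a at *
  have hne : a ≠ -1 / 2 := by
    rintro rfl
    norm_num at hz
  rw [regProduct_eq ⟨by linarith, by linarith⟩ hne, weight, norm_mul, norm_mul, norm_mul, norm_pow (gammaRatio a)]
  have h5 : ‖a‖ ≤ 1 + |a.im| := by
    refine (Complex.norm_le_abs_re_add_abs_im a).trans ?_
    have : |a.re| ≤ 1 := abs_le.2 ⟨by linarith, by linarith⟩
    linarith
  have h6 : ‖resid a‖ ≤ C₂ * (2 + |a.im|) ^ 2 :=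
    (h₂ a h3 h4.le).trans (by gcongr C₂ * ?_ ^ 2; linarith)
  calc _ ≤ Real.exp (2 * Real.pi * |a.im|) * (4 * C₁ ^ 3) * (C₂ * (2 + |a.im|) ^ 2) := by
        gcongr
        · exact norm_cos_pi_sq_le a
        · exact norm_four_cpow_le (by linarith)
        · exact h₁ a h3 hz
    _ = _ := by ring

/-- The cubed Gamma quotient contributes `y^{-3/2}` and `resid` contributes `y`, leaving `y^{-1/2}`
beyond the exponential growth of `cos²`. -/
lemma norm_perProduct_axis_le {C : ℝ} (hC : 0 ≤ C)
    (h : ∀ a : ℂ, a.re = 0 → ‖resid a‖ ≤ C * (1 + ‖a‖)) {y : ℝ} (hy : 1 ≤ y) {a : ℂ} (ha : a.re = 0)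
    (hay : |a.im| = y) (hg : ‖gammaRatio a‖ ^ 2 ≤ 1 / y) :
    ‖perProduct a‖ * Real.exp (-2 * Real.pi * y) ≤ 8 * C * √(1 / y) := by
  have hmem : a - (0 : ℤ) ∈ strip := by simp [strip, ha]
  have hne : a ≠ -1 / 2 := by rintro rfl; norm_num at ha
  have hn : ‖a‖ ≤ y := by
    refine (Complex.norm_le_abs_re_add_abs_im a).trans ?_
    rw [ha, hay]; simp
  rw [perProduct_eq hmem]
  simp only [Int.cast_zero, sub_zero] at hmem ⊢
  rw [regProduct_eq hmem hne, weight, norm_mul, norm_mul, norm_mul, norm_pow (gammaRatio a)]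
  have h1 : ‖gammaRatio a‖ ≤ √(1 / y) := Real.le_sqrt_of_sq_le hg
  have h2 : ‖resid a‖ ≤ C * (2 * y) := (h a ha).trans (by gcongr; linarith)
  have h3 := norm_cos_pi_sq_le a
  rw [hay] at h3
  have h4 := norm_four_cpow_le (a := a) (by rw [ha]; norm_num)
  calc _ ≤ Real.exp (2 * Real.pi * y) * (4 * (1 / y * √(1 / y))) * (C * (2 * y)) *
        Real.exp (-2 * Real.pi * y) := by
        rw [pow_succ ‖gammaRatio a‖]
        gcongr
    _ = 8 * C * √(1 / y) * (Real.exp (2 * Real.pi * y) * Real.exp (-2 * Real.pi * y)) := by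
        field_simp; ring
    _ = _ := by rw [← Real.exp_add]; simp

lemma perProduct_eq_const (z w : ℂ) : perProduct z = perProduct w := by
  obtain ⟨C, hC⟩ := exists_norm_perProduct_le
  obtain ⟨C', hC', -, h'⟩ := exists_norm_resid_le
  have hlim : Tendsto (fun y : ℝ => 8 * C' * √(1 / y)) atTop (𝓝 0) := by
    have h1 : Tendsto (fun y : ℝ => 1 / y) atTop (𝓝 0) := by
      simpa using tendsto_inv_atTop_zero (𝕜 := ℝ)
    have := (h1.sqrt).const_mul (8 * C')
    simpa using this
  refine eq_of_periodic_of_growth differentiable_perProduct periodic_perProduct hC ?_ ?_ z w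
  · refine squeeze_zero' (Eventually.of_forall fun y => by positivity) ?_ hlim
    filter_upwards [eventually_ge_atTop 1] with y hy
    exact norm_perProduct_axis_le hC' h' hy (by simp) (by simp; linarith)
      (norm_gammaRatio_sq_le (by linarith))
  · refine squeeze_zero' (Eventually.of_forall fun y => by positivity) ?_ hlim
    filter_upwards [eventually_ge_atTop 1] with y hy
    refine norm_perProduct_axis_le hC' h' hy (by simp) (by simp; linarith) ?_
    rw [show -(y * Complex.I) = starRingEnd ℂ (y * Complex.I) by simp, gammaRatio_conj,
      RCLike.norm_conj]
    exact norm_gammaRatio_sq_le (by linarith)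

lemma resid_of_mem_strip {a : ℂ} (ha : a ∈ strip) (h : a ≠ -1 / 2) :
    Complex.cos (Real.pi * a) ^ 2 * weight a * resid a =
      4 / Real.pi * Complex.Gamma (1 / 2) ^ 3 := by
  have h0 : (0 : ℂ) ∈ strip := by norm_num [strip]
  have h1 := perProduct_eq_const a 0
  rw [perProduct_eq (n := 0) (by simpa using ha), perProduct_eq (n := 0) (by simpa using h0)] at h1
  simp only [Int.cast_zero, sub_zero] at h1
  rw [regProduct_eq ha h, regProduct_eq h0 (by norm_num), resid_zero] at h1
  rw [h1, weight, gammaRatio]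
  simp
  ring

/-- Left of the strip the identity follows from the functional equation. -/
lemma resid_mul_weight {a : ℂ} (hre : a.re < 1 / 2) (ha : ∀ m : ℕ, a ≠ -((m : ℂ) + 1))
    (hc : Complex.cos (Real.pi * a) ≠ 0) :
    Complex.cos (Real.pi * a) ^ 2 * weight a * resid a =
      4 / Real.pi * Complex.Gamma (1 / 2) ^ 3 := by
  -- `n` unit steps to the right suffice to pass the line `Re a = -1/2`.
  obtain ⟨n, hn⟩ := exists_nat_gt (-a.re - 1 / 2)
  induction n generalizing a with
  | zero =>
    refine resid_of_mem_strip ⟨by norm_num at hn; linarith, hre⟩ ?_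
    rintro rfl
    apply hc
    rw [show (Real.pi : ℂ) * (-1 / 2) = -(Real.pi / 2) by ring, Complex.cos_neg,
      Complex.cos_pi_div_two]
  | succ n ih =>
    have hhalf : a + 1 / 2 ≠ 0 := fun h => hc (by
      rw [show a = -(1 / 2) by linear_combination h,
        show (Real.pi : ℂ) * -(1 / 2) = -(Real.pi / 2) by ring, Complex.cos_neg,
        Complex.cos_pi_div_two])
    by_cases h : a.re < -(1 / 2)
    · have ha1 : ∀ m : ℕ, a + 1 + m ≠ 0 := add_one_add_natCast_ne_zero ha
      have hc' : Complex.cos (Real.pi * (a + 1)) ≠ 0 := by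
        rw [mul_add, mul_one, Complex.cos_add_pi]; exact neg_ne_zero.2 hc
      have := ih (a := a + 1) (by simp; linarith) (fun m hm => ha (m + 1) (by
        push_cast; linear_combination hm)) hc' (by push_cast at hn; simp; linarith)
      rw [← this, cos_sq_add_one, resid_eq h ha1, weight_add_one hhalf (by simpa using ha1 0)]
      ring
    · refine resid_of_mem_strip ⟨by linarith, hre⟩ ?_
      rintro rfl
      norm_num at hhalf

lemma risingC_quotient {a : ℂ} :
    risingC 1 a / risingC (1 / 2) a = Complex.Gamma (1 / 2) * (gammaRatio a)⁻¹ := by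
  rw [risingC, risingC, gammaRatio, Complex.Gamma_one, div_one, inv_div, add_comm 1 a,
    add_comm (1 / 2) a, div_div_eq_mul_div]
  ring

theorem f_eq_rhs₂ {a : ℂ} (hre : a.re < 1 / 2) (ha : ∀ m : ℕ, a ≠ -((m : ℂ) + 1))
    (hc : Complex.cos (Real.pi * a) ≠ 0) :
    f a = 4 / (Real.pi : ℂ) * ((4 : ℂ) ^ a / Complex.cos (Real.pi * a) ^ 2) *
      (risingC 1 a ^ 3 / risingC (1 / 2) a ^ 3) + rhs₂ a := by
  have hpi : (Real.pi : ℂ) ≠ 0 := Complex.ofReal_ne_zero.2 Real.pi_ne_zero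
  have h := resid_mul_weight hre ha hc
  have h4 : (4 : ℂ) ^ a ≠ 0 := by simp [Complex.cpow_eq_zero_iff]
  -- Read off from the identity itself, whose right-hand side is nonzero.
  have hg : gammaRatio a ≠ 0 := by
    intro h0
    rw [weight, h0] at h
    have : Complex.Gamma (1 / 2) ≠ 0 := Complex.Gamma_ne_zero_of_re_pos (by norm_num)
    have h5 : 4 / (Real.pi : ℂ) * Complex.Gamma (1 / 2) ^ 3 ≠ 0 :=
      mul_ne_zero (div_ne_zero (by norm_num) hpi) (pow_ne_zero _ this)
    exact h5 (by rw [← h]; ring)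
  rw [← div_pow, risingC_quotient]
  have h6 : f a = resid a + rhs₂ a := by rw [resid]; ring
  rw [h6]
  congr 1
  rw [weight, Complex.cpow_neg] at h
  field_simp at h ⊢
  linear_combination h

end RamanujanExt

/-! ### The second series at `0`, by Wallis' product. -/

namespace RamanujanExt

open Filter Topology Finset

/-- The central binomial weight `(1/2)_n / n!`. -/
noncomputable def halfRatio (n : ℕ) : ℝ := ∏ i ∈ range n, ((i : ℝ) + 1 / 2) / (i + 1)

lemma halfRatio_zero : halfRatio 0 = 1 := prod_range_zero _

lemma halfRatio_succ (n : ℕ) : halfRatio (n + 1) = halfRatio n * ((n + 1 / 2) / (n + 1)) :=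
  prod_range_succ _ _

lemma halfRatio_pos (n : ℕ) : 0 < halfRatio n := prod_pos fun i _ => by positivity

lemma summable_halfRatio_div {x : ℝ} (hx : 0 < x) : Summable fun n : ℕ => halfRatio n / (n + x) := by
  have h := summable_norm_of_hypergeometric_ratio (p := 1 / 2) (q := x) (r := 1) (t := 1 + x)
    (by norm_num; linarith) (T := fun n : ℕ => ((halfRatio n / (n + x) : ℝ) : ℂ)) fun n => by
      rw [halfRatio_succ]
      have h1 : (n : ℂ) + x ≠ 0 := by exact_mod_cast (by positivity : (n : ℝ) + x ≠ 0)
      have h2 : (n : ℂ) + (1 + x) ≠ 0 := by exact_mod_cast (by positivity : (n : ℝ) + (1 + x) ≠ 0)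
      have h3 : (n : ℂ) + 1 ≠ 0 := by exact_mod_cast (by positivity : (n : ℝ) + 1 ≠ 0)
      push_cast
      rw [add_assoc (n : ℂ) 1]
      field_simp
  refine h.congr fun n => ?_
  have := halfRatio_pos n
  rw [Complex.norm_real, Real.norm_of_nonneg (by positivity)]

/-- The series `∑ (1/2)_n / (n! (n + x))`. -/
noncomputable def halfSum (x : ℝ) : ℝ := ∑' n : ℕ, halfRatio n / (n + x)

/-- This is the recurrence of `B(x, 1/2)`, obtained by telescoping `k · halfRatio k / (k + x)`. -/
lemma halfSum_recurrence {x : ℝ} (hx : 0 < x) : x * halfSum x = (x + 1 / 2) * halfSum (x + 1) := by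
  have h1 := (summable_halfRatio_div hx).mul_left x
  have h2 := (summable_halfRatio_div (x := x + 1) (by linarith)).mul_left (x + 1 / 2)
  have h := tsum_telescope_linear_mul (summable_halfRatio_div hx).norm (α := 0) (β := 1)
    (h2.sub h1) fun k => by
      rw [halfRatio_succ]
      push_cast
      have : 0 < (k : ℝ) + x := by positivity
      have : 0 < (k : ℝ) + 1 + x := by positivity
      have : 0 < (k : ℝ) + (x + 1) := by positivity
      rw [show (k : ℝ) + (x + 1) = k + 1 + x by ring]
      field_simp
      ring
  rw [h2.tsum_sub h1, tsum_mul_left, tsum_mul_left, zero_mul] at h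
  rw [halfSum, halfSum]
  linarith

lemma halfSum_one : halfSum 1 = 2 := by
  have h1 := (summable_halfRatio_div one_pos)
  have h := tsum_telescope_linear_mul h1.norm (α := 1) (β := 1)
    (h1.mul_left (1 / 2)) fun k => by
      rw [halfRatio_succ]
      push_cast
      field_simp
      ring
  rw [tsum_mul_left] at h
  rw [halfRatio_zero] at h
  rw [halfSum]
  norm_num at h
  linarith

lemma halfSum_le_of_le {x y : ℝ} (hx : 0 < x) (hxy : x ≤ y) : halfSum y ≤ halfSum x := by
  refine (summable_halfRatio_div (hx.trans_le hxy)).tsum_le_tsum (fun n => ?_)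
    (summable_halfRatio_div hx)
  have := (halfRatio_pos n).le
  gcongr

lemma halfSum_nat_add_half (m : ℕ) : halfSum (m + 1 / 2) = halfRatio m * halfSum (1 / 2) := by
  induction m with
  | zero => simp [halfRatio]
  | succ k ih =>
    have h := halfSum_recurrence (x := k + 1 / 2) (by positivity)
    rw [ih] at h
    have e : ((k + 1 : ℕ) : ℝ) + 1 / 2 = k + 1 / 2 + 1 := by push_cast; ring
    rw [e, halfRatio_succ]
    field_simp
    field_simp at h
    linarith

lemma halfSum_nat_add_one (m : ℕ) : halfSum (m + 1) = 2 / ((2 * m + 1) * halfRatio m) := by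
  induction m with
  | zero => simp [halfRatio, halfSum_one]
  | succ k ih =>
    have h := halfSum_recurrence (x := k + 1) (by positivity)
    have hp := halfRatio_pos k
    rw [ih] at h
    have e : halfSum ((k + 1 : ℕ) + 1) =
        ((k + 1) * (2 / ((2 * k + 1) * halfRatio k))) / (k + 1 + 1 / 2) := by
      rw [eq_div_iff (by positivity), h]
      push_cast
      ring
    rw [e, halfRatio_succ]
    push_cast
    field_simp

lemma wallis_eq_halfRatio (m : ℕ) : Real.Wallis.W m = 1 / ((2 * m + 1) * halfRatio m ^ 2) := by
  induction m with
  | zero => simp [halfRatio, Real.Wallis.W]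
  | succ k ih =>
    have hp := halfRatio_pos k
    rw [Real.Wallis.W_succ, ih, halfRatio_succ]
    push_cast
    field_simp
    ring

/-- Monotonicity gives `halfSum (m + 3/2) ≤ halfSum (m + 1) ≤ halfSum (m + 1/2)`. The recurrence
makes the outer values multiples of `halfSum (1/2)` and the middle one explicit, which encloses
`halfSum (1/2)` between Wallis products. -/
lemma halfSum_half : halfSum (1 / 2) = Real.pi := by
  have hW : Tendsto (fun m => 2 * Real.Wallis.W m) atTop (𝓝 Real.pi) := by
    have := Real.tendsto_prod_pi_div_two.const_mul 2
    rwa [mul_div_cancel₀ _ two_ne_zero] at this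
  have hW' : Tendsto (fun m : ℕ => 2 * Real.Wallis.W m * (1 + ((2 * m + 1 : ℕ) : ℝ)⁻¹)) atTop
      (𝓝 (Real.pi * (1 + 0))) := by
    refine hW.mul (Tendsto.const_add 1 ?_)
    exact (tendsto_inv_atTop_nhds_zero_nat (𝕜 := ℝ)).comp
      (tendsto_atTop_mono (fun n => (by omega : n ≤ 2 * n + 1)) tendsto_id)
  rw [add_zero, mul_one] at hW'
  refine le_antisymm (ge_of_tendsto' hW' fun m => ?_) (le_of_tendsto' hW fun m => ?_)
  · have hp := halfRatio_pos m
    have h := halfSum_le_of_le (x := m + 1) (y := (m + 1 : ℕ) + 1 / 2) (by positivity)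
      (by push_cast; linarith)
    rw [halfSum_nat_add_half, halfSum_nat_add_one, halfRatio_succ, mul_comm,
      ← le_div_iff₀ (by positivity)] at h
    refine h.trans_eq ?_
    rw [wallis_eq_halfRatio]
    push_cast
    field_simp
    ring
  · have hp := halfRatio_pos m
    have h := halfSum_le_of_le (x := m + 1 / 2) (y := m + 1) (by positivity) (by linarith)
    rw [halfSum_nat_add_half, halfSum_nat_add_one, mul_comm (halfRatio m),
      ← div_le_iff₀ (by positivity)] at h
    refine Eq.trans_le ?_ h
    rw [wallis_eq_halfRatio]
    field_simp

lemma halfRatio_eq (n : ℕ) : (halfRatio n : ℂ) = rising (1 / 2) n / rising 1 n := by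
  induction n with
  | zero => simp [halfRatio, rising_zero]
  | succ k ih =>
    rw [halfRatio_succ, rising_succ, rising_succ, mul_div_mul_comm, ← ih]
    push_cast
    rw [add_comm (k : ℂ), add_comm (k : ℂ)]

lemma tsum_term₂_zero : ∑' n, term₂ 0 n = Real.pi / 2 := by
  have h : ∀ n : ℕ, term₂ 0 n = ((1 / 2 * (halfRatio n / (n + 1 / 2)) : ℝ) : ℂ) := fun n => by
    have h2 : (2 * (n : ℂ) + 1) ≠ 0 := by exact_mod_cast (by positivity : (2 * n + 1 : ℕ) ≠ 0)
    have h3 := rising_ne_zero (x := 3 / 2) (add_natCast_ne_zero_of_re_pos (by norm_num)) n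
    have h4 := rising_ne_zero (x := 1) (add_natCast_ne_zero_of_re_pos (by norm_num)) n
    push_cast
    rw [halfRatio_eq, term₂, zero_add, zero_add, sub_zero, mul_div_mul_comm,
      rising_half_div_rising_three_halves, show (n : ℂ) + 1 / 2 = (2 * n + 1) / 2 by ring]
    field_simp
  simp_rw [h]
  rw [← Complex.ofReal_tsum, tsum_mul_left]
  have := halfSum_half
  rw [halfSum] at this
  rw [this]
  push_cast
  ring

end RamanujanExt

/-! ### Taylor expansion of `f` at `0`. -/

namespace RamanujanExt

open Filter Topology Finset

lemma hasDerivAt_sin_pi (a : ℂ) :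
    HasDerivAt (fun a : ℂ => Complex.sin (Real.pi * a)) (Real.pi * Complex.cos (Real.pi * a)) a := by
  simpa [mul_comm] using ((hasDerivAt_id a).const_mul (Real.pi : ℂ)).csin

lemma hasDerivAt_cos_pi (a : ℂ) :
    HasDerivAt (fun a : ℂ => Complex.cos (Real.pi * a)) (-(Real.pi * Complex.sin (Real.pi * a))) a := by
  simpa [mul_comm] using ((hasDerivAt_id a).const_mul (Real.pi : ℂ)).ccos

/-- The Taylor expansion of `π a cot π a` to second order. -/
lemma deriv_deriv_of_mul_sin_eq {w : ℂ → ℂ} (hw : AnalyticAt ℂ w 0) (h0 : w 0 = 1)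
    (h : ∀ᶠ a in 𝓝 0, w a * Complex.sin (Real.pi * a) = Real.pi * a * Complex.cos (Real.pi * a)) :
    deriv (deriv w) 0 = -2 * Real.pi ^ 2 / 3 := by
  have hpi : (Real.pi : ℂ) ≠ 0 := Complex.ofReal_ne_zero.2 Real.pi_ne_zero
  have hw1 := hw.deriv
  have hw2 := hw1.deriv
  have hid : ∀ a : ℂ, HasDerivAt (fun a : ℂ => (Real.pi : ℂ) * a) Real.pi a := fun a => by
    simpa using (hasDerivAt_id a).const_mul (Real.pi : ℂ)
  -- Since `sin πa` has a simple zero at `0`, the second derivative of `w` appears only after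
  -- differentiating the identity three times.
  have e1 : ∀ᶠ a in 𝓝 0, deriv w a * Complex.sin (Real.pi * a) +
      w a * (Real.pi * Complex.cos (Real.pi * a)) =
      Real.pi * Complex.cos (Real.pi * a) +
        Real.pi * a * -(Real.pi * Complex.sin (Real.pi * a)) := by
    filter_upwards [EventuallyEq.deriv h, hw.eventually_analyticAt] with a ha hwa
    have l := hwa.differentiableAt.hasDerivAt.fun_mul (hasDerivAt_sin_pi a)
    have r := (hid a).fun_mul (hasDerivAt_cos_pi a)
    rwa [l.deriv, r.deriv] at ha
  have e2 : ∀ᶠ a in 𝓝 0, deriv (deriv w) a * Complex.sin (Real.pi * a) +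
      deriv w a * (Real.pi * Complex.cos (Real.pi * a)) +
      (deriv w a * (Real.pi * Complex.cos (Real.pi * a)) +
        w a * (Real.pi * -(Real.pi * Complex.sin (Real.pi * a)))) =
      Real.pi * -(Real.pi * Complex.sin (Real.pi * a)) +
        (Real.pi * -(Real.pi * Complex.sin (Real.pi * a)) +
          Real.pi * a * -(Real.pi * (Real.pi * Complex.cos (Real.pi * a)))) := by
    filter_upwards [EventuallyEq.deriv e1, hw.eventually_analyticAt, hw1.eventually_analyticAt]
      with a ha hwa hwa1
    have l := (hwa1.differentiableAt.hasDerivAt.fun_mul (hasDerivAt_sin_pi a)).fun_add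
      (hwa.differentiableAt.hasDerivAt.fun_mul ((hasDerivAt_cos_pi a).const_mul (Real.pi : ℂ)))
    have r := ((hasDerivAt_cos_pi a).const_mul (Real.pi : ℂ)).fun_add
      ((hid a).fun_mul ((hasDerivAt_sin_pi a).const_mul (Real.pi : ℂ)).fun_neg)
    rwa [l.deriv, r.deriv] at ha
  have e3 := (EventuallyEq.deriv e2).self_of_nhds
  have d0 := hw.differentiableAt.hasDerivAt
  have d1 := hw1.differentiableAt.hasDerivAt
  have d2 := hw2.differentiableAt.hasDerivAt
  have hs := hasDerivAt_sin_pi 0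
  have hc := hasDerivAt_cos_pi 0
  have hns := (hs.const_mul (Real.pi : ℂ)).fun_neg.const_mul (Real.pi : ℂ)
  have l := ((d2.fun_mul hs).fun_add (d1.fun_mul (hc.const_mul (Real.pi : ℂ)))).fun_add
    ((d1.fun_mul (hc.const_mul (Real.pi : ℂ))).fun_add (d0.fun_mul hns))
  have r := hns.fun_add (hns.fun_add ((hid 0).fun_mul
    ((hc.const_mul (Real.pi : ℂ)).const_mul (Real.pi : ℂ)).fun_neg))
  rw [l.deriv, r.deriv] at e3
  simp [h0] at e3
  have h1 : (3 * (Real.pi : ℂ)) * deriv (deriv w) 0 = -2 * Real.pi ^ 3 := by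
    linear_combination e3
  rw [eq_div_iff (by norm_num : (3 : ℂ) ≠ 0)]
  apply mul_left_cancel₀ hpi
  linear_combination h1

/-- The quotient `Γ(1/2) Γ(a + 1) / Γ(a + 1/2)`, normalised at zero. -/
noncomputable def gammaQuot (a : ℂ) : ℂ := Complex.Gamma (1 / 2) * (gammaRatio a)⁻¹

lemma gammaQuot_eq (a : ℂ) : gammaQuot a =
    Complex.Gamma (1 / 2) * (Complex.Gamma (a + 1) * (Complex.Gamma (a + 1 / 2))⁻¹) := by
  rw [gammaQuot, gammaRatio, inv_div, div_eq_mul_inv (Complex.Gamma _)]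

lemma Gamma_half_ne_zero : Complex.Gamma (1 / 2) ≠ 0 :=
  Complex.Gamma_ne_zero_of_re_pos (by norm_num)

lemma gammaQuot_zero : gammaQuot 0 = 1 := by
  rw [gammaQuot_eq, zero_add, zero_add, Complex.Gamma_one, one_mul, mul_inv_cancel₀ Gamma_half_ne_zero]

lemma analyticAt_gammaQuot : AnalyticAt ℂ gammaQuot 0 := by
  have hU : IsOpen {a : ℂ | -1 < a.re} := isOpen_lt continuous_const Complex.continuous_re
  have h1 : Differentiable ℂ fun a : ℂ => (Complex.Gamma (a + 1 / 2))⁻¹ :=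
    Complex.differentiable_one_div_Gamma.comp (by fun_prop : Differentiable ℂ fun a : ℂ => a + 1 / 2)
  have h2 : DifferentiableOn ℂ (fun a => Complex.Gamma (a + 1)) {a : ℂ | -1 < a.re} := fun a ha => by
    have : DifferentiableAt ℂ Complex.Gamma (a + 1) :=
      Complex.differentiableAt_Gamma _ fun m hm => by
        have h3 := congrArg Complex.re hm
        have h4 := m.cast_nonneg (α := ℝ)
        have h5 : -1 < a.re := ha
        norm_num at h3
        linarith
    exact (this.comp a (by fun_prop : DifferentiableAt ℂ (fun a => a + 1) a)).differentiableWithinAt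
  have h3 := ((h2.mul h1.differentiableOn).const_mul (Complex.Gamma (1 / 2))).analyticAt
    (hU.mem_nhds (by simp : (0 : ℂ) ∈ {a : ℂ | -1 < a.re}))
  exact h3.congr (Eventually.of_forall fun a => (gammaQuot_eq a).symm)

lemma Gamma_half_sq : Complex.Gamma (1 / 2) ^ 2 = Real.pi := by
  have := Complex.Gamma_mul_Gamma_one_sub (1 / 2)
  rw [show (1 : ℂ) - 1 / 2 = 1 / 2 by norm_num, mul_one_div, Complex.sin_pi_div_two, div_one] at this
  rw [sq, this]

/-- The derivative is `ψ(1) - ψ(1/2)`, where the Euler constants cancel. -/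
lemma deriv_gammaQuot_zero : deriv gammaQuot 0 = 2 * (Real.log 2 : ℂ) := by
  have hg := Gamma_half_ne_zero
  have h1 : HasDerivAt (fun a : ℂ => Complex.Gamma (a + 1)) (Complex.digamma 1) 0 := by
    have h := Complex.hasDerivAt_Gamma_one
    rw [← Complex.digamma_one] at h
    exact HasDerivAt.comp_add_const 0 1 (by rwa [zero_add])
  have h2 : HasDerivAt (fun a : ℂ => Complex.Gamma (a + 1 / 2))
      (Complex.digamma (1 / 2) * Complex.Gamma (1 / 2)) 0 := by
    have h := Complex.hasDerivAt_Gamma_one_half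
    rw [Complex.digamma_def, logDeriv_apply, div_mul_cancel₀ _ hg, h.deriv]
    exact HasDerivAt.comp_add_const 0 (1 / 2) (by rwa [zero_add])
  have h3 := (h1.fun_mul (h2.fun_inv (by simpa using hg))).const_mul (Complex.Gamma (1 / 2))
  have h4 := h3.congr_of_eventuallyEq (Eventually.of_forall gammaQuot_eq)
  rw [h4.deriv, zero_add, zero_add, Complex.Gamma_one, Complex.digamma_one, Complex.digamma_one_half]
  have : (Real.log 2 : ℂ) = Complex.log 2 := by rw [Complex.ofReal_log (by norm_num)]; norm_num
  rw [this]
  field_simp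
  ring

lemma hasDerivAt_comp_neg {g : ℂ → ℂ} {g' a : ℂ} (h : HasDerivAt g g' (-a)) :
    HasDerivAt (fun a => g (-a)) (-g') a := by
  rw [← mul_neg_one]
  exact h.comp a (hasDerivAt_neg a)

lemma eventually_mem_strip : ∀ᶠ a : ℂ in 𝓝 0, a ∈ strip ∧ a ≠ -1 / 2 := by
  have h1 : ∀ᶠ a : ℂ in 𝓝 0, a ∈ strip := isOpen_strip.mem_nhds (by norm_num [strip])
  have h2 : ∀ᶠ a : ℂ in 𝓝 0, a ≠ -1 / 2 := isOpen_ne.mem_nhds (by norm_num)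
  exact h1.and h2

/-- Reflection gives `v(a) v(-a) = πa cot πa` for `v = gammaQuot`, whose second derivative at `0` is
`2 v'' - 2 v'^2`; no trigamma values are needed. -/
lemma deriv_deriv_gammaQuot_zero :
    deriv (deriv gammaQuot) 0 = deriv gammaQuot 0 ^ 2 - Real.pi ^ 2 / 3 := by
  have hpi : (Real.pi : ℂ) ≠ 0 := Complex.ofReal_ne_zero.2 Real.pi_ne_zero
  have hv := analyticAt_gammaQuot
  have hv1 := hv.deriv
  have hneg : Tendsto (fun a : ℂ => -a) (𝓝 0) (𝓝 0) := by simpa using (continuous_neg (G := ℂ)).tendsto 0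
  have hvn : AnalyticAt ℂ (fun a => gammaQuot (-a)) 0 :=
    AnalyticAt.fun_comp (f := fun a : ℂ => -a) (by simpa using hv) (by fun_prop)
  have hw : AnalyticAt ℂ (fun a => gammaQuot a * gammaQuot (-a)) 0 := hv.mul hvn
  have hev : ∀ᶠ a in 𝓝 0, gammaQuot a * gammaQuot (-a) * Complex.sin (Real.pi * a) =
      Real.pi * a * Complex.cos (Real.pi * a) := by
    have hball := Metric.ball_mem_nhds (0 : ℂ) one_pos
    filter_upwards [eventually_mem_strip, hball] with a ⟨h1, h2⟩ h3
    rcases eq_or_ne a 0 with rfl | ha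
    · simp
    have hc := cos_ne_zero_of_mem_strip h1 h2
    have hsin : Complex.sin (Real.pi * a) ≠ 0 := by
      intro h
      obtain ⟨k, hk⟩ := Complex.sin_eq_zero_iff.1 h
      have hak : a = k := by
        apply mul_left_cancel₀ hpi
        rw [hk, mul_comm]
      rw [hak, mem_ball_zero_iff, Complex.norm_intCast] at h3
      have h4 : |k| < 1 := by exact_mod_cast h3
      rw [Int.abs_lt_one_iff.1 h4] at hak
      exact ha (by simpa using hak)
    have h5 : gammaQuot a * gammaQuot (-a) =
        Complex.Gamma (1 / 2) ^ 2 * (gammaRatio a * gammaRatio (-a))⁻¹ := by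
      rw [gammaQuot, gammaQuot, mul_inv]; ring
    rw [h5, Gamma_half_sq, gammaRatio_mul_gammaRatio_neg ha, Complex.tan]
    field_simp
  have h2 := deriv_deriv_of_mul_sin_eq hw (by simp [gammaQuot_zero]) hev
  have hderiv : deriv (fun a => gammaQuot a * gammaQuot (-a)) =ᶠ[𝓝 0]
      fun a => deriv gammaQuot a * gammaQuot (-a) + gammaQuot a * -(deriv gammaQuot (-a)) := by
    filter_upwards [hv.eventually_analyticAt, hneg.eventually hv.eventually_analyticAt] with a h1 h2
    have h3 := hasDerivAt_comp_neg h2.differentiableAt.hasDerivAt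
    exact (h1.differentiableAt.hasDerivAt.fun_mul h3).deriv
  have d0 := hv.differentiableAt.hasDerivAt
  have d1 := hv1.differentiableAt.hasDerivAt
  have d0n : HasDerivAt (fun a => gammaQuot (-a)) (-(deriv gammaQuot 0)) 0 :=
    hasDerivAt_comp_neg (by simpa using d0)
  have d1n : HasDerivAt (fun a => deriv gammaQuot (-a)) (-(deriv (deriv gammaQuot) 0)) 0 :=
    hasDerivAt_comp_neg (by simpa using d1)
  have d := ((d1.fun_mul d0n).fun_add (d0.fun_mul d1n.fun_neg)).deriv
  rw [hderiv.deriv_eq, d] at h2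
  simp [gammaQuot_zero] at h2
  linear_combination h2 / 2

/-- The Gamma part of the right-hand side of the second identity. -/
noncomputable def gammaPart (a : ℂ) : ℂ :=
  4 / (Real.pi : ℂ) * ((4 : ℂ) ^ a / Complex.cos (Real.pi * a) ^ 2) * gammaQuot a ^ 3

/-- The logarithmic derivative of `gammaPart`. -/
noncomputable def gammaPartLog (a : ℂ) : ℂ :=
  Complex.log 4 + 2 * Real.pi * (Complex.sin (Real.pi * a) / Complex.cos (Real.pi * a)) +
    3 * (deriv gammaQuot a / gammaQuot a)

lemma hasDerivAt_gammaPart {a : ℂ} (hc : Complex.cos (Real.pi * a) ≠ 0) (hv : gammaQuot a ≠ 0)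
    (hd : DifferentiableAt ℂ gammaQuot a) :
    HasDerivAt gammaPart (gammaPart a * gammaPartLog a) a := by
  have h1 : HasDerivAt (fun a : ℂ => (4 : ℂ) ^ a) ((4 : ℂ) ^ a * Complex.log 4) a := by
    simpa using (hasDerivAt_id a).const_cpow (c := 4) (Or.inl (by norm_num))
  have h2 := (((h1.fun_div ((hasDerivAt_cos_pi a).fun_pow 2) (pow_ne_zero 2 hc)).const_mul
    (4 / (Real.pi : ℂ))).fun_mul (hd.hasDerivAt.fun_pow 3))
  refine h2.congr_deriv ?_
  rw [gammaPart, gammaPartLog]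
  field_simp
  push_cast
  ring

lemma gammaPart_zero : gammaPart 0 = 4 / Real.pi := by simp [gammaPart, gammaQuot_zero]

lemma log_four : Complex.log 4 = 2 * (Real.log 2 : ℂ) := by
  have h : Real.log 4 = 2 * Real.log 2 := by
    rw [show (4 : ℝ) = 2 ^ 2 by norm_num, Real.log_pow]; norm_num
  rw [show (4 : ℂ) = ((4 : ℝ) : ℂ) by norm_num, ← Complex.ofReal_log (by norm_num), h]
  push_cast; rfl

lemma gammaPartLog_zero : gammaPartLog 0 = 8 * (Real.log 2 : ℂ) := by
  rw [gammaPartLog, gammaQuot_zero, deriv_gammaQuot_zero, log_four]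
  simp
  ring

lemma hasDerivAt_gammaPartLog_zero : HasDerivAt gammaPartLog (Real.pi ^ 2 : ℂ) 0 := by
  have hv := analyticAt_gammaQuot
  have h1 := ((hasDerivAt_sin_pi 0).fun_div (hasDerivAt_cos_pi 0) (by simp)).const_mul
    (2 * (Real.pi : ℂ))
  have h2 := (hv.deriv.differentiableAt.hasDerivAt.fun_div hv.differentiableAt.hasDerivAt
    (by rw [gammaQuot_zero]; exact one_ne_zero)).const_mul (3 : ℂ)
  refine ((h1.const_add (Complex.log 4)).fun_add h2).congr_deriv ?_
  rw [deriv_deriv_gammaQuot_zero, gammaQuot_zero]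
  simp
  ring

/-- With `a²` factored out, the series does not affect `f'(0)` and enters `f''(0)` only through its
value at `0`. -/
lemma f_eventuallyEq : f =ᶠ[𝓝 0] fun a => gammaPart a +
    a ^ 2 * (16 / (2 * a - 1) * ∑' n, term₂ a n) := by
  filter_upwards [eventually_mem_strip] with a ⟨h1, h2⟩
  have h3 := cos_ne_zero_of_mem_strip h1 h2
  rw [f_eq_rhs₂ h1.2 (ne_neg_natCast_add_one_of_re (by have := h1.1; linarith)) h3, ← div_pow,
    risingC_quotient, rhs₂, gammaPart, gammaQuot]
  ring

lemma analyticAt_series_factor :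
    AnalyticAt ℂ (fun a : ℂ => 16 / (2 * a - 1) * ∑' n, term₂ a n) 0 := by
  have hU : IsOpen {a : ℂ | -1 < a.re ∧ a.re < 1 / 2} :=
    (isOpen_lt continuous_const Complex.continuous_re).inter
      (isOpen_lt Complex.continuous_re continuous_const)
  have h : DifferentiableOn ℂ (fun a : ℂ => 16 / (2 * a - 1) * ∑' n, term₂ a n)
      {a | -1 < a.re ∧ a.re < 1 / 2} := by
    refine DifferentiableOn.mul (fun a ha => ?_) differentiableOn_tsum_term₂
    have := two_mul_sub_one_ne_zero ha.2
    exact DifferentiableAt.differentiableWithinAt (by fun_prop (disch := assumption))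
  exact h.analyticAt (hU.mem_nhds (by norm_num))

lemma analyticAt_f_zero : AnalyticAt ℂ f 0 :=
  differentiableOn_f.analyticAt
    ((isOpen_lt continuous_const Complex.continuous_re).mem_nhds (by norm_num))

lemma deriv_f_eventuallyEq : deriv f =ᶠ[𝓝 0] fun a => gammaPart a * gammaPartLog a +
    (2 * a * (16 / (2 * a - 1) * ∑' n, term₂ a n) +
      a ^ 2 * deriv (fun a : ℂ => 16 / (2 * a - 1) * ∑' n, term₂ a n) a) := by
  have hv := analyticAt_gammaQuot
  have hne : ∀ᶠ a in 𝓝 0, gammaQuot a ≠ 0 :=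
    hv.continuousAt.eventually_ne (by rw [gammaQuot_zero]; exact one_ne_zero)
  filter_upwards [f_eventuallyEq.deriv, eventually_mem_strip, hne, hv.eventually_analyticAt,
    analyticAt_series_factor.eventually_analyticAt] with a ha ⟨h1, h2⟩ h3 h4 h5
  rw [ha]
  have d1 := hasDerivAt_gammaPart (cos_ne_zero_of_mem_strip h1 h2) h3 h4.differentiableAt
  have d2 := (hasDerivAt_pow 2 a).fun_mul h5.differentiableAt.hasDerivAt
  rw [(d1.fun_add d2).deriv]
  simp

lemma deriv_f_zero : deriv f 0 = 32 / (Real.pi : ℂ) * (Real.log 2 : ℂ) := by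
  refine deriv_f_eventuallyEq.self_of_nhds.trans ?_
  simp only [gammaPart_zero, gammaPartLog_zero]
  ring

lemma iteratedDeriv_two_f_zero : iteratedDeriv 2 f 0 =
    4 / (Real.pi : ℂ) * (64 * (Real.log 2 : ℂ) ^ 2 - 3 * (Real.pi : ℂ) ^ 2) := by
  have hpi : (Real.pi : ℂ) ≠ 0 := Complex.ofReal_ne_zero.2 Real.pi_ne_zero
  rw [iteratedDeriv_succ, iteratedDeriv_one, deriv_f_eventuallyEq.deriv_eq]
  have d1 := (hasDerivAt_gammaPart (a := 0) (by simp) (by rw [gammaQuot_zero]; exact one_ne_zero)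
    analyticAt_gammaQuot.differentiableAt).fun_mul hasDerivAt_gammaPartLog_zero
  have hk := analyticAt_series_factor
  have hid : HasDerivAt (fun a : ℂ => 2 * a) 2 0 := by
    simpa using (hasDerivAt_id (0 : ℂ)).const_mul (2 : ℂ)
  have d2 := (hid.fun_mul hk.differentiableAt.hasDerivAt).fun_add
    ((hasDerivAt_pow 2 (0 : ℂ)).fun_mul hk.deriv.differentiableAt.hasDerivAt)
  -- The Gamma part gives `(4/π)(64 ln² 2 + π²)`, and the series gives `2 · (-16) · π/2 = -16π`.
  rw [(d1.fun_add d2).deriv, gammaPart_zero, gammaPartLog_zero, tsum_term₂_zero]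
  simp
  field_simp
  ring

end RamanujanExt

theorem mainTheorem1 :
    -- the series of `f` converges wherever its terms are defined
    (∀ a : ℂ, (∀ m : ℕ, a ≠ -((m : ℂ) + 1)) → Summable (RamanujanExt.fTerm a)) ∧
    -- the first identity, wherever its right-hand side converges
    (∀ a : ℂ, 0 < a.re →
      Summable (RamanujanExt.term₁ a) ∧
      RamanujanExt.f a = 8 * a * ∑' n : ℕ, RamanujanExt.term₁ a n) ∧
    -- the second identity, wherever its right-hand side is defined and converges
    (∀ a : ℂ, a.re < 1 / 2 → (∀ m : ℕ, a ≠ -((m : ℂ) + 1)) →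
      Complex.cos ((Real.pi : ℂ) * a) ≠ 0 →
      Summable (RamanujanExt.term₂ a) ∧
      RamanujanExt.f a =
        4 / (Real.pi : ℂ) * ((4 : ℂ) ^ a / Complex.cos ((Real.pi : ℂ) * a) ^ 2) *
            (RamanujanExt.risingC 1 a ^ 3 / RamanujanExt.risingC (1 / 2) a ^ 3) +
          16 * a ^ 2 / (2 * a - 1) * ∑' n : ℕ, RamanujanExt.term₂ a n) ∧
    -- the evaluations
    RamanujanExt.f (1 / 2) = (Real.pi : ℂ) ^ 2 / 2 ∧
    RamanujanExt.f 0 = 4 / (Real.pi : ℂ) ∧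
    AnalyticAt ℂ RamanujanExt.f 0 ∧
    deriv RamanujanExt.f 0 = 32 / (Real.pi : ℂ) * (Real.log 2 : ℂ) ∧
    iteratedDeriv 2 RamanujanExt.f 0 =
      4 / (Real.pi : ℂ) * (64 * (Real.log 2 : ℂ) ^ 2 - 3 * (Real.pi : ℂ) ^ 2) := by
  refine ⟨fun a _ => RamanujanExt.summable_fTerm a, fun a ha => ?_, fun a hre ha hc => ?_,
    RamanujanExt.f_half, RamanujanExt.f_zero, RamanujanExt.analyticAt_f_zero,
    RamanujanExt.deriv_f_zero, RamanujanExt.iteratedDeriv_two_f_zero⟩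
  · exact ⟨(RamanujanExt.summable_norm_term₁ ha).of_norm, RamanujanExt.f_eq_rhs₁ ha⟩
  · exact ⟨(RamanujanExt.summable_norm_term₂ hre).of_norm, RamanujanExt.f_eq_rhs₂ hre ha hc⟩
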